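/- Let $N\ge 1$ be an integer. For a holomorphic map $f:\mathbb C\to\mathbb CP^N$, written locally as $f=[f_0:f_1:\dots:f_N]$ with holomorphic functions $f_i$ without common zeros, define the spherical derivative $|df|(z)\ge 0$ by $$|df|^2(z)=\frac1{4\pi}\,\Delta\log\bigl(|f_0|^2+\dots+|f_N|^2\bigr)(z),\qquad \Delta=\frac{\partial^2}{\partial x^2}+\frac{\partial^2}{\partial y^2},$$ (which does not depend on the choice of the $f_i$), and put $\|df\|_{L^\infty(D)}=\sup_{z\in D}|df|(z)$ for $D\subset\mathbb C$. The map $f$ is a Brody curve if it is holomorphic and $|df|(z)\le 1$ for all $z\in\mathbb C$. A Brody curve $f$ is non-degenerate if there are $\delta>0$ and $R>0$ such that $\|df\|_{L^\infty(D_R(a))}\ge\delta$ for every $a\in\mathbb C$, where $D_R(a)=\{z:|z-a|\le R\}$. The energy density of a Brody curve $f$ is $$\rho(f)=\lim_{R\to\infty}\frac1{\pi R^2}\Bigl(\sup_{a\in\mathbb C}\int_{|z-a|<R}|df|^2\,dx\,dy\Bigr).$$ **Theorem.** Let $f:\mathbb C\to\mathbb CP^N$ be a holomorphic map with $\|df\|_{L^\infty(\mathbb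 C)}<1$. Then for every $\varepsilon>0$ there exists a non-degenerate Brody curve $g:\mathbb C\to\mathbb CP^N$ with $\|dg\|_{L^\infty(\mathbb C)}<1$ and $\rho(g)\ge\rho(f)-\varepsilon$. (In particular, the limits defining $\rho(f)$ and $\rho(g)$ exist.) -/

import Mathlib

open Filter Topology MeasureTheory
open scoped ENNReal

namespace BrodyCurves

/-- Complex projective space `ℂP^N`, the lines of `ℂ^{N+1}`. -/
abbrev CP (N : ℕ) : Type := Projectivization ℂ (EuclideanSpace ℂ (Fin (N + 1)))

/-- `F = (F₀, …, F_N)` is a holomorphic system of homogeneous coordinates for `f` near `z`: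
it is holomorphic near `z`, has no zero there, and `f = [F₀ : … : F_N]` near `z`. -/
def IsLocalLift {N : ℕ} (f : ℂ → CP N) (z : ℂ)
    (F : ℂ → EuclideanSpace ℂ (Fin (N + 1))) : Prop :=
  AnalyticAt ℂ F z ∧ ∀ᶠ w in 𝓝 z, ∃ h : F w ≠ 0, Projectivization.mk ℂ (F w) h = f w

/-- A map `f : ℂ → ℂP^N` is holomorphic if near every point it is given by holomorphic
homogeneous coordinates without common zeros. -/
def IsHolomorphic {N : ℕ} (f : ℂ → CP N) : Prop :=
  ∀ z : ℂ, ∃ F : ℂ → EuclideanSpace ℂ (Fin (N + 1)), IsLocalLift f z F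

/-- The expression `(1 / 4π) Δ log (|F₀|² + … + |F_N|²)` at `z`, with
`Δ = ∂²/∂x² + ∂²/∂y²`. -/
noncomputable def laplaceLog {N : ℕ} (F : ℂ → EuclideanSpace ℂ (Fin (N + 1))) (z : ℂ) : ℝ :=
  1 / (4 * Real.pi) *
    Laplacian.laplacian (fun w : ℂ => Real.log (∑ i, ‖F w i‖ ^ 2)) z

open Classical in
/-- The spherical derivative `|df|(z) ≥ 0`, where
`|df|²(z) = (1 / 4π) Δ log (|F₀|² + … + |F_N|²) (z)` for holomorphic homogeneous coordinates
`F` of `f` near `z`. By `sphericalDeriv_eq` below, all choices of `F` give the same value. -/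
noncomputable def sphericalDeriv {N : ℕ} (f : ℂ → CP N) (z : ℂ) : ℝ :=
  if h : ∃ F, IsLocalLift f z F then Real.sqrt (laplaceLog h.choose z) else 0

theorem laplaceLog_eq_of_isLocalLift {N : ℕ} {f : ℂ → CP N} {z : ℂ}
    {F G : ℂ → EuclideanSpace ℂ (Fin (N + 1))}
    (hF : IsLocalLift f z F) (hG : IsLocalLift f z G) : laplaceLog F z = laplaceLog G z := by
  obtain ⟨hFa, hFe⟩ := hF
  obtain ⟨hGa, hGe⟩ := hG
  obtain ⟨hG0, -⟩ := hGe.self_of_nhds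
  obtain ⟨i, hi⟩ : ∃ i, G z i ≠ 0 := by
    by_contra! hcon
    exact hG0 (by ext i; simpa using hcon i)
  have coord : ∀ {H : ℂ → EuclideanSpace ℂ (Fin (N + 1))}, AnalyticAt ℂ H z → ∀ j,
      AnalyticAt ℂ (fun w => H w j) z := fun {H} hH j =>
    ((EuclideanSpace.proj j : EuclideanSpace ℂ (Fin (N + 1)) →L[ℂ] ℂ).analyticAt _).comp hH
  set c : ℂ → ℂ := fun w => F w i / G w i with hc
  have hca : AnalyticAt ℂ c z := (coord hFa i).div (coord hGa i) hi
  have hGi : ∀ᶠ w in 𝓝 z, G w i ≠ 0 := (coord hGa i).continuousAt.eventually_ne hi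
  have key : ∀ᶠ w in 𝓝 z, G w ≠ 0 ∧ c w ≠ 0 ∧ F w = c w • G w := by
    filter_upwards [hFe, hGe, hGi] with w hFw hGw hw
    obtain ⟨h1, e1⟩ := hFw
    obtain ⟨h2, e2⟩ := hGw
    obtain ⟨a, ha⟩ := (Projectivization.mk_eq_mk_iff' ℂ _ _ h1 h2).1 (e1.trans e2.symm)
    have hac : c w = a := by
      simp only [hc]
      rw [← ha]
      simp [hw]
    refine ⟨h2, ?_, by rw [hac, ha]⟩
    rw [hac]
    rintro rfl
    exact h1 (by rw [← ha, zero_smul])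
  have hsum : ∀ v : EuclideanSpace ℂ (Fin (N + 1)), ∑ j, ‖v j‖ ^ 2 = ‖v‖ ^ 2 := fun v =>
    (EuclideanSpace.norm_sq_eq v).symm
  have hlog : (fun w => Real.log (∑ j, ‖F w j‖ ^ 2)) =ᶠ[𝓝 z]
      ((2 : ℝ) • fun w => Real.log ‖c w‖) + fun w => Real.log (∑ j, ‖G w j‖ ^ 2) := by
    filter_upwards [key] with w hw
    obtain ⟨h1, h2, h3⟩ := hw
    simp only [hsum, Pi.add_apply, Pi.smul_apply, smul_eq_mul]
    rw [h3, norm_smul, mul_pow, Real.log_mul (by simpa using h2) (by simpa using h1),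
      Real.log_pow]
    simp
  have hharm : InnerProductSpace.HarmonicAt (fun w => Real.log ‖c w‖) z :=
    hca.harmonicAt_log_norm key.self_of_nhds.2.1
  have hGs : ContDiffAt ℝ 2 (fun w => Real.log (∑ j, ‖G w j‖ ^ 2)) z := by
    refine ContDiffAt.log ?_ (by rw [hsum]; simpa using hG0)
    refine ContDiffAt.sum fun j _ => ?_
    exact ((coord hGa j).contDiffAt.restrict_scalars ℝ).norm_sq ℝ
  have hharm2 := hharm.const_smul (c := (2 : ℝ))
  unfold laplaceLog
  rw [(InnerProductSpace.laplacian_congr_nhds hlog).self_of_nhds,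
    ContDiffAt.laplacian_add hharm2.1 hGs, hharm2.2.self_of_nhds]
  simp

/-- The spherical derivative does not depend on the choice of homogeneous coordinates. -/
theorem sphericalDeriv_eq {N : ℕ} {f : ℂ → CP N} {z : ℂ}
    {F : ℂ → EuclideanSpace ℂ (Fin (N + 1))} (hF : IsLocalLift f z F) :
    sphericalDeriv f z = Real.sqrt (laplaceLog F z) := by
  have h : ∃ F, IsLocalLift f z F := ⟨F, hF⟩
  rw [sphericalDeriv, dif_pos h, laplaceLog_eq_of_isLocalLift h.choose_spec hF]

/-- The supremum norm of `|df|` over a set `D`, with values in `[0, ∞]`. -/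
noncomputable def derivSupNorm {N : ℕ} (f : ℂ → CP N) (D : Set ℂ) : ℝ≥0∞ :=
  ⨆ z ∈ D, ENNReal.ofReal (sphericalDeriv f z)

/-- A Brody curve: a holomorphic map `ℂ → ℂP^N` with `|df| ≤ 1` everywhere. -/
def IsBrodyCurve {N : ℕ} (f : ℂ → CP N) : Prop :=
  IsHolomorphic f ∧ ∀ z : ℂ, sphericalDeriv f z ≤ 1

/-- A non-degenerate Brody curve: for some `δ > 0` and `R > 0`, the supremum of `|df|` over
every closed disk of radius `R` is at least `δ`. -/
def IsNondegenerateBrodyCurve {N : ℕ} (f : ℂ → CP N) : Prop :=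
  IsBrodyCurve f ∧ ∃ δ : ℝ, 0 < δ ∧ ∃ R : ℝ, 0 < R ∧
    ∀ a : ℂ, ENNReal.ofReal δ ≤ derivSupNorm f (Metric.closedBall a R)

/-- `(1 / πR²) sup_{a ∈ ℂ} ∫_{|z - a| < R} |df|² dxdy`. -/
noncomputable def meanEnergy {N : ℕ} (f : ℂ → CP N) (R : ℝ) : ℝ :=
  1 / (Real.pi * R ^ 2) * ⨆ a : ℂ, ∫ z in Metric.ball a R, sphericalDeriv f z ^ 2

/-- The energy density `ρ(f) = lim_{R → ∞} (1 / πR²) sup_a ∫_{|z - a| < R} |df|² dxdy`. -/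
noncomputable def energyDensity {N : ℕ} (f : ℂ → CP N) : ℝ :=
  limUnder atTop (meanEnergy f)

end BrodyCurves

/-!
Far from the poles, adding to a curve `f` a sum of terms `(6 / (z - M n))³` with large spacing `M`
changes homogeneous coordinates, and hence `|df|`, only by `O(M⁻³)`. Such a pole is placed at `M n`,
for a Gaussian integer `n`, exactly when `f` is almost constant on the disk of radius `M / 2` around
`M n`, meaning `|df| ≤ 1 / (400 M)` there. Adding `(6 / (z - M n))³ ⟨v, F⟩ u`, with `v` spanning the
line `f (M n)`, `u` a unit vector orthogonal to `v`, and `F` homogeneous coordinates of `f`, makes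
the new curve nearly the cubic rational curve `[v + (6 / (z - M n))³ u]` in that disk; its spherical
derivative is bounded below on the circle of radius `6`, and it stays at most `4 / 5`. So the new
curve is non-degenerate, still has norm less than `1`, and loses energy only where `|df|` is at most
`1 / (400 M)`, or by the `O(M⁻³)` perturbation, which for large `M` is smaller still.

The energy density exists because, by Fubini, averaging the masses of balls of radius `R` centred in
a ball of radius `R'` bounds the largest mass density at scale `R'` by that at scale `R`, up to a
factor tending to `1` as `R' → ∞`.
-/

namespace BrodyCurves

section BallDensity

variable {E : Type*} [NormedAddCommGroup E] [MeasurableSpace E] (μ ν : Measure E)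

/-- The largest `ν`-mass of a ball of radius `R`, relative to the `μ`-mass of such a ball (which
does not depend on the center when `μ` is translation invariant). -/
noncomputable def maxBallDensity (R : ℝ) : ℝ≥0∞ :=
  (⨆ c, ν (Metric.ball c R)) / μ (Metric.ball 0 R)

variable {μ} in
theorem maxBallDensity_le_add [BorelSpace E] [μ.IsAddHaarMeasure] {ν₁ ν₂ : Measure E}
    {c : ℝ≥0∞} (h : ν₁ ≤ ν₂ + c • μ) (R : ℝ) :
    maxBallDensity μ ν₁ R ≤ maxBallDensity μ ν₂ R + c := by
  have hball (a : E) : ν₁ (Metric.ball a R) ≤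
      (⨆ a, ν₂ (Metric.ball a R)) + c * μ (Metric.ball 0 R) := by
    calc ν₁ (Metric.ball a R) ≤ ν₂ (Metric.ball a R) + c * μ (Metric.ball a R) := h _
      _ ≤ _ := by
        rw [Measure.addHaar_ball_center μ]
        gcongr
        exact le_iSup (fun a => ν₂ (Metric.ball a R)) a
  calc maxBallDensity μ ν₁ R
      ≤ ((⨆ a, ν₂ (Metric.ball a R)) + c * μ (Metric.ball 0 R)) / μ (Metric.ball 0 R) :=
        ENNReal.div_le_div_right (iSup_le hball) _
    _ ≤ maxBallDensity μ ν₂ R + c := by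
        rw [ENNReal.add_div, maxBallDensity]
        gcongr
        rw [mul_div_assoc]
        exact mul_le_of_le_one_right' ENNReal.div_self_le_one

variable [NormedSpace ℝ E] [FiniteDimensional ℝ E] [BorelSpace E] [μ.IsAddHaarMeasure] [SFinite ν]

theorem lintegral_measure_ball (R : ℝ) :
    ∫⁻ c, ν (Metric.ball c R) ∂μ = μ (Metric.ball 0 R) * ν Set.univ := by
  have hS : MeasurableSet {p : E × E | dist p.2 p.1 < R} :=
    measurableSet_lt (measurable_snd.dist measurable_fst) measurable_const
  have hball : ∀ x : E, (fun c => (c, x)) ⁻¹' {p : E × E | dist p.2 p.1 < R} = Metric.ball x R :=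
    fun x => by ext c; simp [dist_comm]
  calc ∫⁻ c, ν (Metric.ball c R) ∂μ
      = μ.prod ν {p : E × E | dist p.2 p.1 < R} := (Measure.prod_apply hS).symm
    _ = ∫⁻ x, μ (Metric.ball x R) ∂ν := by simp only [Measure.prod_apply_symm hS, hball]
    _ = μ (Metric.ball 0 R) * ν Set.univ := by
        simp only [Measure.addHaar_ball_center, lintegral_const]

theorem measure_ball_mul_measure_ball_le (a : E) (R R' : ℝ) :
    μ (Metric.ball 0 R) * ν (Metric.ball a R') ≤
      μ (Metric.ball 0 (R + R')) * ⨆ c, ν (Metric.ball c R) := by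
  set ν' := ν.restrict (Metric.ball a R')
  have hle : ∀ c, ν' (Metric.ball c R) ≤
      (Metric.ball a (R + R')).indicator (fun _ => ⨆ c, ν (Metric.ball c R)) c := fun c => by
    by_cases hc : c ∈ Metric.ball a (R + R')
    · rw [Set.indicator_of_mem hc]
      exact (Measure.restrict_apply_le _ _).trans (le_iSup (fun c => ν (Metric.ball c R)) c)
    · have hdisj : Disjoint (Metric.ball c R) (Metric.ball a R') :=
        Metric.ball_disjoint_ball (not_lt.1 hc)
      simp [ν', Measure.restrict_apply measurableSet_ball, hdisj.inter_eq]
  calc μ (Metric.ball 0 R) * ν (Metric.ball a R')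
      = ∫⁻ c, ν' (Metric.ball c R) ∂μ := by
        rw [lintegral_measure_ball, Measure.restrict_apply_univ]
    _ ≤ ∫⁻ c, (Metric.ball a (R + R')).indicator (fun _ => ⨆ c, ν (Metric.ball c R)) c ∂μ :=
        lintegral_mono hle
    _ = μ (Metric.ball 0 (R + R')) * ⨆ c, ν (Metric.ball c R) := by
        rw [lintegral_indicator_const measurableSet_ball, Measure.addHaar_ball_center, mul_comm]

theorem maxBallDensity_le_ofReal_mul {R R' : ℝ} (hR : 0 < R) (hR' : 0 < R') :
    maxBallDensity μ ν R' ≤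
      ENNReal.ofReal ((1 + R / R') ^ Module.finrank ℝ E) * maxBallDensity μ ν R := by
  have hscale : μ (Metric.ball 0 (R + R')) =
      ENNReal.ofReal ((1 + R / R') ^ Module.finrank ℝ E) * μ (Metric.ball 0 R') := by
    rw [← Measure.addHaar_ball_mul_of_pos μ 0 (by positivity : 0 < 1 + R / R')]
    congr 2
    field_simp
    ring
  have hpos : ∀ {r : ℝ}, 0 < r → μ (Metric.ball (0 : E) r) ≠ 0 := fun hr =>
    (Metric.measure_ball_pos μ 0 hr).ne'
  have hfin : ∀ r : ℝ, μ (Metric.ball (0 : E) r) ≠ ∞ := fun r => measure_ball_lt_top.ne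
  rw [maxBallDensity, maxBallDensity, ENNReal.div_le_iff (hpos hR') (hfin R')]
  refine iSup_le fun a => ?_
  calc ν (Metric.ball a R')
      ≤ (μ (Metric.ball 0 (R + R')) * ⨆ c, ν (Metric.ball c R)) / μ (Metric.ball 0 R) := by
        rw [ENNReal.le_div_iff_mul_le (.inl (hpos hR)) (.inl (hfin R)), mul_comm]
        exact measure_ball_mul_measure_ball_le μ ν a R R'
    _ = _ := by
        rw [hscale]
        simp only [div_eq_mul_inv]
        ring

theorem tendsto_maxBallDensity :
    Tendsto (maxBallDensity μ ν) atTop (𝓝 (⨅ R : Set.Ioi (0 : ℝ), maxBallDensity μ ν R)) := by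
  refine tendsto_order.2 ⟨fun c hc => ?_, fun c hc => ?_⟩
  · filter_upwards [eventually_gt_atTop 0] with R hR
    exact hc.trans_le (iInf_le (fun R : Set.Ioi (0 : ℝ) => maxBallDensity μ ν R) ⟨R, hR⟩)
  · obtain ⟨⟨R, hR⟩, hRc⟩ := iInf_lt_iff.1 hc
    have hlim : Tendsto (fun R' : ℝ => ENNReal.ofReal ((1 + R / R') ^ Module.finrank ℝ E) *
        maxBallDensity μ ν R) atTop (𝓝 (maxBallDensity μ ν R)) := by
      have h := ((tendsto_const_nhds (x := R)).div_atTop tendsto_id).const_add 1 |>.pow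
        (Module.finrank ℝ E)
      have h' := ENNReal.Tendsto.mul_const (b := maxBallDensity μ ν R) (ENNReal.tendsto_ofReal h)
        (.inl (by simp))
      simpa using h'
    filter_upwards [hlim.eventually_lt_const hRc, eventually_gt_atTop 0] with R' hR'c hR'
    exact (maxBallDensity_le_ofReal_mul μ ν hR hR').trans_lt hR'c

end BallDensity

section FubiniStudy

variable {E : Type*} [NormedAddCommGroup E] [InnerProductSpace ℂ E]

/-- The length of the tangent vector of `ℙ(E)` at `[x]` represented by `y`, for the Fubini–Study
metric normalized so that it is `‖y‖ / ‖x‖` when `y` is orthogonal to `x`. -/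
noncomputable def fsDeriv (x y : E) : ℝ :=
  ‖(ℂ ∙ x)ᗮ.starProjection y‖ / ‖x‖

theorem fsDeriv_nonneg (x y : E) : 0 ≤ fsDeriv x y := by
  unfold fsDeriv; positivity

theorem fsDeriv_le (x y : E) : fsDeriv x y ≤ ‖y‖ / ‖x‖ := by
  unfold fsDeriv
  gcongr
  exact Submodule.norm_starProjection_apply_le _ y

theorem fsDeriv_of_inner_eq_zero {x y : E} (h : inner ℂ x y = 0) : fsDeriv x y = ‖y‖ / ‖x‖ := by
  rw [fsDeriv, Submodule.starProjection_eq_self_iff.2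
    (Submodule.mem_orthogonal_singleton_iff_inner_right.2 h)]

theorem fsDeriv_sub_smul (x y : E) (c : ℂ) : fsDeriv x (y - c • x) = fsDeriv x y := by
  rw [fsDeriv, map_sub, map_smul, Submodule.starProjection_orthogonalComplement_singleton_eq_zero,
    smul_zero, sub_zero, fsDeriv]

theorem starProjection_orthogonal_span_singleton (x y : E) :
    (ℂ ∙ x)ᗮ.starProjection y = y - (inner ℂ x y / (‖x‖ : ℂ) ^ 2) • x := by
  rw [Submodule.starProjection_orthogonal']
  simp [Submodule.starProjection_singleton]

theorem exists_inner_sub_smul_eq_zero (x y : E) : ∃ c : ℂ, inner ℂ x (y - c • x) = 0 :=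
  ⟨_, starProjection_orthogonal_span_singleton x y ▸
    Submodule.mem_orthogonal_singleton_iff_inner_right.1 (Submodule.starProjection_apply_mem _ y)⟩

theorem fsDeriv_sq {x : E} (hx : x ≠ 0) (y : E) :
    fsDeriv x y ^ 2 = ‖y‖ ^ 2 / ‖x‖ ^ 2 - ‖inner ℂ x y‖ ^ 2 / ‖x‖ ^ 4 := by
  have hx' : ‖x‖ ≠ 0 := norm_ne_zero_iff.2 hx
  have hproj : ‖(ℂ ∙ x).starProjection y‖ = ‖inner ℂ x y‖ / ‖x‖ := by
    rw [Submodule.starProjection_singleton, norm_smul, norm_div, RCLike.norm_ofReal,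
      abs_of_nonneg (by positivity)]
    field_simp
  have hpyth := Submodule.norm_sq_eq_add_norm_sq_starProjection y (ℂ ∙ x)
  rw [hproj] at hpyth
  rw [fsDeriv, div_pow, hpyth]
  field_simp
  ring

/-- The real linear form `ξ ↦ re (c ξ)` on `ℂ`, real linear in `c`. It turns complex gradients
into real derivatives. -/
noncomputable def reMul : ℂ →L[ℝ] ℂ →L[ℝ] ℝ :=
  (ContinuousLinearMap.compL ℝ ℂ ℂ ℝ Complex.reCLM).comp (ContinuousLinearMap.mul ℝ ℂ)

theorem reMul_apply (c ξ : ℂ) : reMul c ξ = (c * ξ).re := rfl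

theorem hasFDerivAt_norm_sq {F : ℂ → E} {F' : E} {z : ℂ} (h : HasDerivAt F F' z) :
    HasFDerivAt (fun w => ‖F w‖ ^ 2) (reMul (2 * inner ℂ (F z) F')) z := by
  have hreal : HasFDerivAt F _ z := h.hasFDerivAt.restrictScalars ℝ
  refine (Complex.reCLM.hasFDerivAt.comp z (hreal.inner ℂ hreal)).congr_of_eventuallyEq
    (.of_forall fun w => (inner_self_eq_norm_sq (𝕜 := ℂ) (F w)).symm) |>.congr_fderiv ?_
  ext ξ
  have hre : (inner ℂ F' (F z)).re = (inner ℂ (F z) F').re := inner_re_symm (𝕜 := ℂ) F' (F z)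
  have him : (inner ℂ F' (F z)).im = -(inner ℂ (F z) F').im := inner_im_symm (𝕜 := ℂ) F' (F z)
  simp only [ContinuousLinearMap.comp_apply, ContinuousLinearMap.prod_apply, fderivInnerCLM_apply,
    ContinuousLinearMap.coe_restrictScalars', ContinuousLinearMap.toSpanSingleton_apply,
    inner_smul_left, inner_smul_right, Complex.reCLM_apply, reMul_apply, Complex.add_re,
    Complex.mul_re, Complex.mul_im, Complex.conj_re, Complex.conj_im, hre, him, Complex.re_ofNat,
    Complex.im_ofNat]
  ring

theorem hasFDerivAt_log_norm_sq {F : ℂ → E} {F' : E} {z : ℂ} (h : HasDerivAt F F' z)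
    (h0 : F z ≠ 0) :
    HasFDerivAt (fun w => Real.log (‖F w‖ ^ 2))
      (reMul ((‖F z‖ ^ 2)⁻¹ • (2 * inner ℂ (F z) F'))) z := by
  rw [map_smul]
  exact (hasFDerivAt_norm_sq h).log (by simpa using h0)

theorem laplacian_eq_of_hasFDerivAt_reMul {φ : ℂ → ℝ} {q : ℂ → ℂ} {L : ℂ →L[ℝ] ℂ} {z : ℂ}
    (hφ : ∀ᶠ w in 𝓝 z, HasFDerivAt φ (reMul (q w)) w) (hq : HasFDerivAt q L z) :
    Laplacian.laplacian φ z = (L 1).re - (L Complex.I).im := by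
  have hfderiv : fderiv ℝ φ =ᶠ[𝓝 z] reMul ∘ q := hφ.mono fun w hw => hw.fderiv
  have hsecond : fderiv ℝ (fderiv ℝ φ) z = reMul.comp L :=
    hfderiv.fderiv_eq.trans (reMul.hasFDerivAt.comp z hq).fderiv
  simp only [InnerProductSpace.laplacian_eq_iteratedFDeriv_complexPlane, iteratedFDeriv_two_apply,
    hsecond, Matrix.cons_val_zero, Matrix.cons_val_one, ContinuousLinearMap.comp_apply, reMul_apply,
    mul_one, Complex.mul_re, Complex.I_re, Complex.I_im]
  ring

theorem laplacian_log_norm_sq {F : ℂ → E} {F'' : E} {z : ℂ}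
    (hF : ∀ᶠ w in 𝓝 z, DifferentiableAt ℂ F w) (hF' : HasDerivAt (deriv F) F'' z)
    (h0 : F z ≠ 0) :
    Laplacian.laplacian (fun w => Real.log (‖F w‖ ^ 2)) z =
      4 * fsDeriv (F z) (deriv F z) ^ 2 := by
  have hFz := hF.self_of_nhds
  have hgrad : ∀ᶠ w in 𝓝 z, HasFDerivAt (fun w => Real.log (‖F w‖ ^ 2))
      (reMul ((‖F w‖ ^ 2)⁻¹ • (2 * inner ℂ (F w) (deriv F w)))) w := by
    filter_upwards [hF, hFz.continuousAt.eventually_ne h0] with w hw hw0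
      using hasFDerivAt_log_norm_sq hw.hasDerivAt hw0
  have hnorm : ‖F z‖ ^ 2 ≠ 0 := by simpa using h0
  have hinner := ((hFz.hasDerivAt.hasFDerivAt.restrictScalars ℝ).inner ℂ
    (hF'.hasFDerivAt.restrictScalars ℝ)).const_mul (2 : ℂ)
  have hinv := (hasDerivAt_inv hnorm).comp_hasFDerivAt z (hasFDerivAt_norm_sq hFz.hasDerivAt)
  have hself : inner ℂ (deriv F z) (deriv F z) = ((‖deriv F z‖ ^ 2 : ℝ) : ℂ) := by
    rw [inner_self_eq_norm_sq_to_K, Complex.ofReal_pow]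
    rfl
  rw [laplacian_eq_of_hasFDerivAt_reMul hgrad (hinv.smul hinner), fsDeriv_sq h0,
    ← Complex.normSq_eq_norm_sq (inner ℂ _ _), Complex.normSq_apply]
  simp only [Function.comp_apply, add_apply, smul_apply, ContinuousLinearMap.smulRight_apply,
    ContinuousLinearMap.comp_apply, ContinuousLinearMap.prod_apply, fderivInnerCLM_apply,
    ContinuousLinearMap.coe_restrictScalars', ContinuousLinearMap.toSpanSingleton_apply,
    inner_smul_left, inner_smul_right, hself, reMul_apply, Complex.add_re, Complex.add_im,
    Complex.smul_re, Complex.smul_im, smul_eq_mul, Complex.mul_re, Complex.mul_im, Complex.conj_re,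
    Complex.conj_im, Complex.ofReal_re, Complex.ofReal_im, Complex.I_re, Complex.I_im,
    Complex.one_re, Complex.one_im, Complex.re_ofNat, Complex.im_ofNat]
  field_simp
  ring

end FubiniStudy

section FubiniStudyPerturbation

variable {E : Type*} [NormedAddCommGroup E]

theorem le_norm_add_of_norm_le {x q : E} {κ : ℝ} (hq : ‖q‖ ≤ κ * ‖x‖) :
    (1 - κ) * ‖x‖ ≤ ‖x + q‖ := by
  linarith [norm_sub_le_norm_add x q]

variable [InnerProductSpace ℂ E]

theorem fsDeriv_add_add_le {x y q p : E} {κ σ : ℝ} (hx : x ≠ 0) (hxy : inner ℂ x y = 0)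
    (hκ : κ < 1) (hq : ‖q‖ ≤ κ * ‖x‖) (hp : ‖p‖ ≤ σ * ‖x‖) :
    (1 - κ) * fsDeriv (x + q) (y + p) ≤ fsDeriv x y + σ := by
  have hκ' : 0 < 1 - κ := sub_pos.2 hκ
  have hxq := le_norm_add_of_norm_le hq
  calc (1 - κ) * fsDeriv (x + q) (y + p)
      ≤ (1 - κ) * (‖y + p‖ / ((1 - κ) * ‖x‖)) := by
        gcongr
        exact (fsDeriv_le _ _).trans (by gcongr)
    _ = ‖y + p‖ / ‖x‖ := by field_simp
    _ ≤ (‖y‖ + σ * ‖x‖) / ‖x‖ := by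
        gcongr
        exact (norm_add_le y p).trans (by gcongr)
    _ = fsDeriv x y + σ := by
        rw [fsDeriv_of_inner_eq_zero hxy]
        field_simp

theorem le_fsDeriv_add_add {x y q p : E} {κ σ : ℝ} (hx : x ≠ 0) (hxy : inner ℂ x y = 0)
    (hκ : κ < 1) (hq : ‖q‖ ≤ κ * ‖x‖) (hp : ‖p‖ ≤ σ * ‖x‖) :
    (1 - κ) * fsDeriv x y - σ ≤ (1 + κ) * fsDeriv (x + q) (y + p) := by
  have hx0 : 0 < ‖x‖ := norm_pos_iff.2 hx
  have hκ0 : 0 ≤ κ := nonneg_of_mul_nonneg_left ((norm_nonneg q).trans hq) hx0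
  have hxq0 : 0 < ‖x + q‖ := (mul_pos (sub_pos.2 hκ) hx0).trans_le (le_norm_add_of_norm_le hq)
  obtain ⟨c, hc⟩ := exists_inner_sub_smul_eq_zero (x + q) (y + p)
  have hpyth : ‖y - c • x‖ ^ 2 = ‖y‖ ^ 2 + (‖c‖ * ‖x‖) ^ 2 := by
    have := norm_sub_sq (𝕜 := ℂ) y (c • x)
    rw [inner_smul_right, inner_eq_zero_symm.1 hxy, mul_zero, map_zero, norm_smul] at this
    linarith
  have hle : ‖y‖ ≤ ‖y - c • x‖ ∧ ‖c‖ * ‖x‖ ≤ ‖y - c • x‖ :=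
    ⟨le_of_sq_le_sq (by nlinarith) (norm_nonneg _), le_of_sq_le_sq (by nlinarith) (norm_nonneg _)⟩
  have herr : ‖p - c • q‖ ≤ σ * ‖x‖ + κ * ‖y - c • x‖ := by
    refine (norm_sub_le _ _).trans (add_le_add hp ?_)
    rw [norm_smul]
    calc ‖c‖ * ‖q‖ ≤ ‖c‖ * (κ * ‖x‖) := by gcongr
      _ = κ * (‖c‖ * ‖x‖) := by ring
      _ ≤ κ * ‖y - c • x‖ := by gcongr; exact hle.2
  have hsplit : y + p - c • (x + q) = (y - c • x) + (p - c • q) := by module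
  have hnum : (1 - κ) * ‖y‖ - σ * ‖x‖ ≤ ‖y + p - c • (x + q)‖ := by
    rw [hsplit]
    have := norm_sub_le_norm_add (y - c • x) (p - c • q)
    nlinarith [hle.1]
  calc (1 - κ) * fsDeriv x y - σ = ((1 - κ) * ‖y‖ - σ * ‖x‖) / ‖x‖ := by
        rw [fsDeriv_of_inner_eq_zero hxy]
        field_simp
    _ ≤ ‖y + p - c • (x + q)‖ / ‖x‖ := by gcongr
    _ = fsDeriv (x + q) (y + p) * ‖x + q‖ / ‖x‖ := by
        rw [← fsDeriv_sub_smul _ _ c, fsDeriv_of_inner_eq_zero hc, div_mul_cancel₀ _ hxq0.ne']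
    _ ≤ fsDeriv (x + q) (y + p) * ((1 + κ) * ‖x‖) / ‖x‖ := by
        gcongr
        · exact fsDeriv_nonneg _ _
        · linarith [norm_add_le x q]
    _ = (1 + κ) * fsDeriv (x + q) (y + p) := by field_simp

theorem abs_fsDeriv_clm_sub_fsDeriv_le {x y : E} {T T' : E →L[ℂ] E} {η : ℝ} (hx : x ≠ 0)
    (hη : η ≤ 1 / 2) (hT : ‖T‖ ≤ η) (hT' : ‖T'‖ ≤ η) (hD : fsDeriv x y ≤ 2) :
    |fsDeriv (x + T x) (y + (T' x + T y)) - fsDeriv x y| ≤ 10 * η := by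
  obtain ⟨c, hc⟩ := exists_inner_sub_smul_eq_zero x y
  have hη0 : 0 ≤ η := (norm_nonneg T).trans hT
  set y₀ := y - c • x with hy₀
  have hxT : ‖T x‖ ≤ η * ‖x‖ := T.le_of_opNorm_le hT x
  have hy₀_norm : ‖y₀‖ = fsDeriv x y * ‖x‖ := by
    rw [← fsDeriv_sub_smul x y c, fsDeriv_of_inner_eq_zero hc,
      div_mul_cancel₀ _ (norm_ne_zero_iff.2 hx)]
  have hp : ‖T' x + T y₀‖ ≤ (η * (1 + fsDeriv x y)) * ‖x‖ := by
    calc ‖T' x + T y₀‖ ≤ η * ‖x‖ + η * ‖y₀‖ :=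
          norm_add_le_of_le (T'.le_of_opNorm_le hT' x) (T.le_of_opNorm_le hT y₀)
      _ = (η * (1 + fsDeriv x y)) * ‖x‖ := by rw [hy₀_norm]; ring
  have hshift : fsDeriv (x + T x) (y + (T' x + T y)) = fsDeriv (x + T x) (y₀ + (T' x + T y₀)) := by
    rw [← fsDeriv_sub_smul _ _ c, hy₀, map_sub, map_smul]
    congr 1
    module
  have hupper := fsDeriv_add_add_le hx hc (by linarith) hxT hp
  have hlower := le_fsDeriv_add_add hx hc (by linarith) hxT hp
  rw [fsDeriv_sub_smul] at hupper hlower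
  rw [hshift, abs_le]
  constructor <;> nlinarith [fsDeriv_nonneg x y]

section Orthonormal

variable {v u X X' : E}

theorem norm_sq_smul_add_smul (hv : ‖v‖ = 1) (hu : ‖u‖ = 1) (hvu : inner ℂ v u = 0) (a c : ℂ) :
    ‖a • v + c • u‖ ^ 2 = ‖a‖ ^ 2 + ‖c‖ ^ 2 := by
  have horth : inner ℂ (a • v) (c • u) = 0 := by
    rw [inner_smul_left, inner_smul_right, hvu, mul_zero, mul_zero]
  have := norm_add_sq_eq_norm_sq_add_norm_sq_of_inner_eq_zero _ _ horth
  simpa only [← sq, norm_smul, hv, hu, mul_one] using this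

theorem norm_sq_smul_add (hv : ‖v‖ = 1) (hu : ‖u‖ = 1) (hvu : inner ℂ v u = 0) (a : ℂ) :
    ‖a • v + u‖ ^ 2 = 1 + ‖a‖ ^ 2 := by
  simpa [add_comm] using norm_sq_smul_add_smul hv hu hvu a 1

theorem norm_smul_sub_le_mul_norm_smul_add {κ : ℝ} (hv : ‖v‖ = 1) (hu : ‖u‖ = 1)
    (hvu : inner ℂ v u = 0) (hX : ‖X - v‖ ≤ κ) (a : ℂ) :
    ‖a • (X - v)‖ ≤ κ * ‖a • v + u‖ := by
  have ha : ‖a‖ ≤ ‖a • v + u‖ :=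
    le_of_sq_le_sq (by linarith [norm_sq_smul_add hv hu hvu a]) (norm_nonneg _)
  rw [norm_smul, mul_comm]
  exact mul_le_mul hX ha (norm_nonneg _) ((norm_nonneg _).trans hX)

theorem smul_add_ne_zero {κ : ℝ} (hv : ‖v‖ = 1) (hu : ‖u‖ = 1) (hvu : inner ℂ v u = 0)
    (hκ : κ < 1) (hX : ‖X - v‖ ≤ κ) (a : ℂ) : a • X + u ≠ 0 := by
  have hq := norm_smul_sub_le_mul_norm_smul_add hv hu hvu hX a
  have hx : 0 < ‖a • v + u‖ := by
    refine (sq_pos_iff.1 ?_).lt_of_le' (norm_nonneg _)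
    rw [norm_sq_smul_add hv hu hvu]
    positivity
  rw [show a • X + u = a • v + u + a • (X - v) by module, ← norm_pos_iff]
  exact (mul_pos (sub_pos.2 hκ) hx).trans_le (le_norm_add_of_norm_le hq)

theorem inner_smul_add_smul_sub_eq_zero (hv : ‖v‖ = 1) (hu : ‖u‖ = 1) (hvu : inner ℂ v u = 0)
    (a b : ℂ) : inner ℂ (a • v + u) (b • v - (starRingEnd ℂ a * b) • u) = 0 := by
  have huv : inner ℂ u v = 0 := inner_eq_zero_symm.1 hvu
  simp only [inner_add_left, inner_sub_right, inner_smul_left, inner_smul_right, hvu, huv,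
    inner_self_eq_norm_sq_to_K, hv, hu, map_one]
  ring

theorem norm_smul_sub_smul (hv : ‖v‖ = 1) (hu : ‖u‖ = 1) (hvu : inner ℂ v u = 0) (a b : ℂ) :
    ‖b • v - (starRingEnd ℂ a * b) • u‖ = ‖b‖ * ‖a • v + u‖ := by
  rw [← sq_eq_sq₀ (norm_nonneg _) (by positivity), sub_eq_add_neg, ← neg_smul,
    norm_sq_smul_add_smul hv hu hvu, norm_neg, norm_mul, RCLike.norm_conj, mul_pow, mul_pow,
    norm_sq_smul_add hv hu hvu]
  ring

theorem fsDeriv_smul_add_eq {a a' b : ℂ} (hb : a' = b * (1 + ‖a‖ ^ 2 : ℝ)) :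
    fsDeriv (a • X + u) (a' • X + a • X') = fsDeriv (a • v + u + a • (X - v))
      (b • v - (starRingEnd ℂ a * b) • u + (b • (X - v) + a • X')) := by
  have ha' : a' - starRingEnd ℂ a * b * a = b := by
    rw [hb, Complex.ofReal_add, Complex.ofReal_pow, ← Complex.conj_mul']
    push_cast
    ring
  rw [← fsDeriv_sub_smul _ _ (starRingEnd ℂ a * b)]
  congr 1
  · module
  · linear_combination (norm := module) ha' • X

/-- With `β = ‖a'‖ / (1 + ‖a‖²)`, the Fubini–Study derivative of `a • v + u`, these bounds come
from comparing the curve `a • X + u` with the curve `a • v + u` in the line through `v` and `u`. -/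
theorem fsDeriv_smul_add_bounds {a a' : ℂ} {κ σ : ℝ} (hv : ‖v‖ = 1) (hu : ‖u‖ = 1)
    (hvu : inner ℂ v u = 0) (hκ : κ < 1) (hX : ‖X - v‖ ≤ κ) (hX' : ‖X'‖ ≤ σ) :
    (1 - κ) * fsDeriv (a • X + u) (a' • X + a • X') ≤
        (1 + κ) * (‖a'‖ / (1 + ‖a‖ ^ 2)) + σ ∧
      (1 - 2 * κ) * (‖a'‖ / (1 + ‖a‖ ^ 2)) - σ ≤
        (1 + κ) * fsDeriv (a • X + u) (a' • X + a • X') := by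
  have hσ0 : 0 ≤ σ := (norm_nonneg _).trans hX'
  set b : ℂ := a' / ((1 + ‖a‖ ^ 2 : ℝ) : ℂ) with hb
  set x : E := a • v + u
  set y : E := b • v - (starRingEnd ℂ a * b) • u with hy_def
  have hx_sq : ‖x‖ ^ 2 = 1 + ‖a‖ ^ 2 := norm_sq_smul_add hv hu hvu a
  have hx1 : 1 ≤ ‖x‖ := le_of_sq_le_sq (by nlinarith [sq_nonneg ‖a‖]) (norm_nonneg _)
  have hax : ‖a‖ ≤ ‖x‖ := le_of_sq_le_sq (by linarith) (norm_nonneg _)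
  have hx : x ≠ 0 := norm_pos_iff.1 (by linarith)
  have hb_norm : ‖b‖ = ‖a'‖ / (1 + ‖a‖ ^ 2) := by
    rw [hb, norm_div, Complex.norm_real, Real.norm_of_nonneg (by positivity)]
  have hxy : inner ℂ x y = 0 := inner_smul_add_smul_sub_eq_zero hv hu hvu a b
  have hfs : fsDeriv x y = ‖b‖ := by
    rw [fsDeriv_of_inner_eq_zero hxy, hy_def, norm_smul_sub_smul hv hu hvu,
      mul_div_cancel_right₀ _ (norm_ne_zero_iff.2 hx)]
  have hq : ‖a • (X - v)‖ ≤ κ * ‖x‖ := norm_smul_sub_le_mul_norm_smul_add hv hu hvu hX a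
  have hp : ‖b • (X - v) + a • X'‖ ≤ (‖b‖ * κ + σ) * ‖x‖ := by
    calc ‖b • (X - v) + a • X'‖ ≤ ‖b‖ * κ + ‖a‖ * σ := by
          refine norm_add_le_of_le ?_ ?_ <;> rw [norm_smul] <;> gcongr
      _ ≤ ‖b‖ * κ * ‖x‖ + σ * ‖x‖ := by
          have hκ0 : 0 ≤ κ := (norm_nonneg _).trans hX
          nlinarith [mul_nonneg (norm_nonneg b) hκ0]
      _ = _ := by ring
  have hshift : fsDeriv (a • X + u) (a' • X + a • X') =
      fsDeriv (x + a • (X - v)) (y + (b • (X - v) + a • X')) :=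
    fsDeriv_smul_add_eq (div_mul_cancel₀ a'
      (Complex.ofReal_ne_zero.2 (by positivity : 1 + ‖a‖ ^ 2 ≠ 0))).symm
  have hupper := fsDeriv_add_add_le hx hxy hκ hq hp
  have hlower := le_fsDeriv_add_add hx hxy hκ hq hp
  rw [hfs, hb_norm, ← hshift] at hupper hlower
  constructor <;> linarith

theorem norm_sub_sq_of_inner_eq_one {x : E} (hv : ‖v‖ = 1) (hvx : inner ℂ v x = 1) :
    ‖x - v‖ ^ 2 = ‖x‖ ^ 2 - 1 := by
  rw [norm_sub_sq (𝕜 := ℂ), ← inner_re_symm, hvx, hv, RCLike.one_re]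
  ring

theorem norm_le_fsDeriv_mul {x y : E} (hv : ‖v‖ = 1) (hvx : inner ℂ v x = 1)
    (hvy : inner ℂ v y = 0) : ‖y‖ ≤ fsDeriv x y * (‖x‖ + ‖x‖ ^ 2) := by
  obtain ⟨c, hc⟩ := exists_inner_sub_smul_eq_zero x y
  have hx : ‖x‖ ≠ 0 := norm_ne_zero_iff.2 fun h => by simp [h] at hvx
  have hnorm : ‖y - c • x‖ = fsDeriv x y * ‖x‖ := by
    rw [← fsDeriv_sub_smul x y c, fsDeriv_of_inner_eq_zero hc, div_mul_cancel₀ _ hx]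
  have hc_le : ‖c‖ ≤ fsDeriv x y * ‖x‖ := by
    have := norm_inner_le_norm (𝕜 := ℂ) v (y - c • x)
    rwa [inner_sub_right, inner_smul_right, hvx, hvy, mul_one, zero_sub, norm_neg, hv, one_mul,
      hnorm] at this
  calc ‖y‖ = ‖(y - c • x) + c • x‖ := by rw [sub_add_cancel]
    _ ≤ fsDeriv x y * ‖x‖ + fsDeriv x y * ‖x‖ * ‖x‖ := by
        refine norm_add_le_of_le hnorm.le ?_
        rw [norm_smul]
        gcongr
    _ = fsDeriv x y * (‖x‖ + ‖x‖ ^ 2) := by ring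

end Orthonormal

end FubiniStudyPerturbation

theorem continuousAt_fsDeriv {E X : Type*} [NormedAddCommGroup E] [InnerProductSpace ℂ E]
    [TopologicalSpace X] {F G : X → E} {a : X} (hF : ContinuousAt F a) (hG : ContinuousAt G a)
    (h0 : F a ≠ 0) : ContinuousAt (fun b => fsDeriv (F b) (G b)) a := by
  have hnorm : ‖F a‖ ≠ 0 := norm_ne_zero_iff.2 h0
  have hsq : (‖F a‖ : ℂ) ^ 2 ≠ 0 := by simpa using h0
  simp only [fsDeriv, starProjection_orthogonal_span_singleton]
  fun_prop (disch := assumption)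

section Lifts

variable {N : ℕ} {f : ℂ → CP N} {z : ℂ} {F : ℂ → EuclideanSpace ℂ (Fin (N + 1))}

theorem IsLocalLift.ne_zero (hF : IsLocalLift f z F) : F z ≠ 0 :=
  hF.2.self_of_nhds.1

theorem IsLocalLift.eventually (hF : IsLocalLift f z F) : ∀ᶠ w in 𝓝 z, IsLocalLift f w F :=
  hF.1.eventually_analyticAt.and hF.2.eventually_nhds

theorem IsLocalLift.smul {a : ℂ → ℂ} (hF : IsLocalLift f z F) (ha : AnalyticAt ℂ a z)
    (ha0 : a z ≠ 0) : IsLocalLift f z (fun w => a w • F w) := by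
  refine ⟨ha.smul hF.1, ?_⟩
  filter_upwards [hF.2, ha.continuousAt.eventually_ne ha0] with w ⟨hFw, hfw⟩ haw
  refine ⟨smul_ne_zero haw hFw, hfw ▸ ?_⟩
  exact (Projectivization.mk_eq_mk_iff' ℂ _ _ _ _).2 ⟨a w, rfl⟩

theorem sphericalDeriv_eq_fsDeriv (hF : IsLocalLift f z F) :
    sphericalDeriv f z = fsDeriv (F z) (deriv F z) / √Real.pi := by
  have hlap := laplacian_log_norm_sq (hF.1.eventually_analyticAt.mono fun _ h => h.differentiableAt)
    hF.1.deriv.differentiableAt.hasDerivAt hF.ne_zero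
  simp only [EuclideanSpace.norm_sq_eq] at hlap
  rw [sphericalDeriv_eq hF, laplaceLog, hlap, ← mul_assoc, div_mul_eq_mul_div, one_mul,
    mul_comm 4 Real.pi, div_mul_cancel_right₀ (by norm_num), inv_mul_eq_div,
    Real.sqrt_div (sq_nonneg _), Real.sqrt_sq (fsDeriv_nonneg _ _)]

theorem sphericalDeriv_nonneg (f : ℂ → CP N) (z : ℂ) : 0 ≤ sphericalDeriv f z := by
  unfold sphericalDeriv
  split_ifs
  · exact Real.sqrt_nonneg _
  · exact le_rfl

theorem IsHolomorphic.continuous_sphericalDeriv (hf : IsHolomorphic f) :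
    Continuous (sphericalDeriv f) := by
  refine continuous_iff_continuousAt.2 fun z => ?_
  obtain ⟨F, hF⟩ := hf z
  refine ((continuousAt_fsDeriv hF.1.continuousAt hF.1.deriv.continuousAt
    hF.ne_zero).div_const (√Real.pi)).congr ?_
  filter_upwards [hF.eventually] with w hw using (sphericalDeriv_eq_fsDeriv hw).symm

theorem exists_isLocalLift_inner_deriv_eq_zero (hf : IsHolomorphic f) (z : ℂ) :
    ∃ F, IsLocalLift f z F ∧ inner ℂ (F z) (deriv F z) = 0 := by
  obtain ⟨F, hF⟩ := hf z
  obtain ⟨c, hc⟩ := exists_inner_sub_smul_eq_zero (F z) (deriv F z)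
  have hexp : HasDerivAt (fun w => Complex.exp (-c * (w - z))) (-c) z := by
    simpa using (((hasDerivAt_id z).sub_const z).const_mul (-c)).cexp
  refine ⟨_, hF.smul (a := fun w => Complex.exp (-c * (w - z))) (by fun_prop)
    (Complex.exp_ne_zero _), ?_⟩
  rw [(hexp.fun_smul hF.1.differentiableAt.hasDerivAt).deriv]
  simpa [sub_eq_add_neg] using hc

theorem IsLocalLift.inv_inner_smul {v : EuclideanSpace ℂ (Fin (N + 1))} (hF : IsLocalLift f z F)
    (h0 : inner ℂ v (F z) ≠ 0) : IsLocalLift f z (fun w => (inner ℂ v (F w))⁻¹ • F w) :=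
  hF.smul ((((innerSL ℂ v).analyticAt _).comp hF.1).inv h0) (inv_ne_zero h0)

/-- The squared cosine of the angle between the vector `v` and the line `p`. -/
noncomputable def cosSq (v : EuclideanSpace ℂ (Fin (N + 1))) (p : CP N) : ℝ :=
  ‖inner ℂ v p.rep‖ ^ 2 / ‖p.rep‖ ^ 2

theorem cosSq_mk (v : EuclideanSpace ℂ (Fin (N + 1))) {x : EuclideanSpace ℂ (Fin (N + 1))}
    (hx : x ≠ 0) : cosSq v (Projectivization.mk ℂ x hx) = ‖inner ℂ v x‖ ^ 2 / ‖x‖ ^ 2 := by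
  obtain ⟨a, ha⟩ := Projectivization.exists_smul_eq_mk_rep ℂ x hx
  have ha0 : ‖(a : ℂ)‖ ^ 2 ≠ 0 := by simp
  rw [cosSq, ← ha, Units.smul_def, inner_smul_right, norm_smul, norm_mul, mul_pow, mul_pow,
    mul_div_mul_left _ _ ha0]

theorem norm_reMul_le (c : ℂ) : ‖reMul c‖ ≤ ‖c‖ :=
  ContinuousLinearMap.opNorm_le_bound _ (norm_nonneg c) fun ξ => by
    simpa [reMul_apply] using Complex.abs_re_le_norm (c * ξ)

theorem exists_hasFDerivAt_cosSq (hf : IsHolomorphic f) {v : EuclideanSpace ℂ (Fin (N + 1))}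
    (hv : ‖v‖ = 1) (z : ℂ) : ∃ L : ℂ →L[ℝ] ℝ, HasFDerivAt (fun w => cosSq v (f w)) L z ∧
      ‖L‖ ≤ 2 * √Real.pi * sphericalDeriv f z := by
  obtain ⟨F, hF, hnormal⟩ := exists_isLocalLift_inner_deriv_eq_zero hf z
  have hFz : 0 < ‖F z‖ := norm_pos_iff.2 hF.ne_zero
  have hderiv := hF.1.differentiableAt.hasDerivAt
  have hnum := hasFDerivAt_norm_sq ((innerSL ℂ v).hasFDerivAt.comp_hasDerivAt z hderiv)
  have hden := (hasDerivAt_inv (pow_pos hFz 2).ne').comp_hasFDerivAt z (hasFDerivAt_norm_sq hderiv)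
  have hquot : HasFDerivAt (fun w => ‖inner ℂ v (F w)‖ ^ 2 * (‖F w‖ ^ 2)⁻¹)
      ((‖F z‖ ^ 2)⁻¹ • reMul (2 * inner ℂ (innerSL ℂ v (F z)) (innerSL ℂ v (deriv F z)))) z := by
    refine (hnum.mul hden).congr_fderiv ?_
    rw [hnormal, mul_zero, map_zero, smul_zero, smul_zero, zero_add]
    rfl
  have heq : (fun w => cosSq v (f w)) =ᶠ[𝓝 z] fun w => ‖inner ℂ v (F w)‖ ^ 2 * (‖F w‖ ^ 2)⁻¹ := by
    filter_upwards [hF.2] with w ⟨hFw, hfw⟩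
    rw [← hfw, cosSq_mk, div_eq_mul_inv]
  refine ⟨_, hquot.congr_of_eventuallyEq heq, ?_⟩
  have hsph : 2 * √Real.pi * sphericalDeriv f z = 2 * (‖deriv F z‖ / ‖F z‖) := by
    rw [sphericalDeriv_eq_fsDeriv hF, fsDeriv_of_inner_eq_zero hnormal]
    field_simp
  have hinner (y : EuclideanSpace ℂ (Fin (N + 1))) : ‖inner ℂ v y‖ ≤ ‖y‖ := by
    simpa [hv] using norm_inner_le_norm (𝕜 := ℂ) v y
  have hgrad : ‖reMul (2 * inner ℂ (innerSL ℂ v (F z)) (innerSL ℂ v (deriv F z)))‖ ≤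
      2 * (‖F z‖ * ‖deriv F z‖) := by
    refine (norm_reMul_le _).trans ?_
    rw [norm_mul, Complex.norm_ofNat]
    gcongr
    exact (norm_inner_le_norm _ _).trans
      (mul_le_mul (hinner _) (hinner _) (norm_nonneg _) (norm_nonneg _))
  rw [hsph, norm_smul, Real.norm_of_nonneg (by positivity)]
  calc _ ≤ (‖F z‖ ^ 2)⁻¹ * (2 * (‖F z‖ * ‖deriv F z‖)) := by gcongr
    _ = 2 * (‖deriv F z‖ / ‖F z‖) := by field_simp

theorem abs_cosSq_sub_le (hf : IsHolomorphic f) {v : EuclideanSpace ℂ (Fin (N + 1))}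
    (hv : ‖v‖ = 1) {b : ℂ} {r d : ℝ}
    (hd : ∀ w ∈ Metric.closedBall b r, sphericalDeriv f w ≤ d) (hz : z ∈ Metric.closedBall b r) :
    |cosSq v (f z) - cosSq v (f b)| ≤ 2 * √Real.pi * d * ‖z - b‖ := by
  choose L hL hL_norm using exists_hasFDerivAt_cosSq hf hv
  refine (convex_closedBall b r).norm_image_sub_le_of_norm_hasFDerivWithin_le
    (fun w _ => (hL w).hasFDerivWithinAt) (fun w hw => (hL_norm w).trans ?_)
    (Metric.mem_closedBall_self (Metric.nonempty_closedBall.1 ⟨z, hz⟩)) hz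
  gcongr
  exact hd w hw

end Lifts

section RemovableSingularities

variable {E : Type*} [NormedAddCommGroup E] [InnerProductSpace ℂ E] {p G G₁ G₂ : ℂ → E} {z : ℂ}

/-- `G` represents the projective class of `p` holomorphically and without zeros near `z`, where
only the values of `p` away from `z` matter. It is used for `p` meromorphic with a pole at `z`. -/
structure IsPuncturedLift (p : ℂ → E) (z : ℂ) (G : ℂ → E) : Prop where
  analyticAt : AnalyticAt ℂ G z
  ne_zero : G z ≠ 0
  eventually_eq_smul : ∀ᶠ w in 𝓝[≠] z, ∃ c : ℂ, G w = c • p w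

theorem IsPuncturedLift.eventually [CompleteSpace E] (hG : IsPuncturedLift p z G) :
    ∀ᶠ w in 𝓝 z, IsPuncturedLift p w G := by
  have hpunctured : ∀ᶠ w in 𝓝[≠] z, ∀ᶠ y in 𝓝[≠] w, ∃ c : ℂ, G y = c • p y := by
    filter_upwards [eventually_eventually_nhdsWithin.2 hG.eventually_eq_smul, self_mem_nhdsWithin]
      with w hw hwz
    rw [isOpen_compl_singleton.nhdsWithin_eq hwz] at hw
    exact hw.filter_mono nhdsWithin_le_nhds
  filter_upwards [hG.analyticAt.eventually_analyticAt,
    hG.analyticAt.continuousAt.eventually_ne hG.ne_zero, eventually_nhdsWithin_iff.1 hpunctured]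
    with w hwa hw0 hw
  obtain rfl | hwz := eq_or_ne w z
  · exact hG
  · exact ⟨hwa, hw0, hw hwz⟩

theorem IsPuncturedLift.exists_eq_smul (h₁ : IsPuncturedLift p z G₁)
    (h₂ : IsPuncturedLift p z G₂) : ∃ c : ℂ, c • G₁ z = G₂ z := by
  have hprop : ∀ᶠ w in 𝓝[≠] z, inner ℂ (G₁ z) (G₁ w) • G₂ w = inner ℂ (G₁ z) (G₂ w) • G₁ w := by
    filter_upwards [h₁.eventually_eq_smul, h₂.eventually_eq_smul] with w ⟨c₁, hc₁⟩ ⟨c₂, hc₂⟩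
    simp only [hc₁, hc₂, inner_smul_right, smul_smul]
    ring_nf
  have hc₁ := h₁.analyticAt.continuousAt
  have hc₂ := h₂.analyticAt.continuousAt
  have heq : inner ℂ (G₁ z) (G₁ z) • G₂ z = inner ℂ (G₁ z) (G₂ z) • G₁ z :=
    ((ContinuousAt.eventuallyEq_nhds_iff_eventuallyEq_nhdsNE
      ((continuousAt_const.inner hc₁).smul hc₂) ((continuousAt_const.inner hc₂).smul hc₁)).1
      hprop).self_of_nhds
  refine ⟨(inner ℂ (G₁ z) (G₁ z))⁻¹ * inner ℂ (G₁ z) (G₂ z), ?_⟩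
  rw [mul_smul, ← heq, inv_smul_smul₀ (inner_self_ne_zero.2 h₁.ne_zero)]

theorem exists_isLocalLift_of_isPuncturedLift {N : ℕ} {p : ℂ → EuclideanSpace ℂ (Fin (N + 1))}
    (hp : ∀ z, ∃ G, IsPuncturedLift p z G) :
    ∃ g : ℂ → CP N, ∀ z G, IsPuncturedLift p z G → IsLocalLift g z G := by
  choose G₀ hG₀ using hp
  refine ⟨fun w => Projectivization.mk ℂ (G₀ w w) (hG₀ w).ne_zero, fun z G hG =>
    ⟨hG.analyticAt, hG.eventually.mono fun w hw => ⟨hw.ne_zero, ?_⟩⟩⟩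
  exact (Projectivization.mk_eq_mk_iff' ℂ _ _ _ _).2 ((hG₀ w).exists_eq_smul hw)

end RemovableSingularities

section Energy

variable {N : ℕ} {f g : ℂ → CP N}

/-- The energy distribution `|df|² dxdy` of `f`. -/
noncomputable def energyMeasure (f : ℂ → CP N) : Measure ℂ :=
  volume.withDensity fun z => ENNReal.ofReal (sphericalDeriv f z ^ 2)

instance (f : ℂ → CP N) : SFinite (energyMeasure f) :=
  inferInstanceAs (SFinite (volume.withDensity _))

theorem energyMeasure_le_add (hg : IsHolomorphic g) {ε : ℝ}
    (h : ∀ z, sphericalDeriv f z ^ 2 ≤ sphericalDeriv g z ^ 2 + ε) :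
    energyMeasure f ≤ energyMeasure g + ENNReal.ofReal ε • volume := by
  have hmeas : Measurable fun z => ENNReal.ofReal (sphericalDeriv g z ^ 2) :=
    (hg.continuous_sphericalDeriv.pow 2).measurable.ennreal_ofReal
  rw [energyMeasure, energyMeasure, ← withDensity_const, ← withDensity_add_left hmeas]
  exact withDensity_mono (.of_forall fun z =>
    (ENNReal.ofReal_le_ofReal (h z)).trans ENNReal.ofReal_add_le)

theorem IsBrodyCurve.energyMeasure_le (hf : IsBrodyCurve f) : energyMeasure f ≤ volume := by
  refine (withDensity_mono (.of_forall fun z => ?_)).trans_eq withDensity_one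
  exact ENNReal.ofReal_le_one.2 (pow_le_one₀ (sphericalDeriv_nonneg f z) (hf.2 z))

theorem IsBrodyCurve.maxBallDensity_energyMeasure_ne_top (hf : IsBrodyCurve f) (R : ℝ) :
    maxBallDensity volume (energyMeasure f) R ≠ ∞ := by
  have hle := maxBallDensity_le_add (μ := volume) (ν₂ := 0) (c := 1)
    (by simpa using hf.energyMeasure_le) R
  exact ne_top_of_le_ne_top (by simp [maxBallDensity]) hle

theorem IsBrodyCurve.meanEnergy_eq (hf : IsBrodyCurve f) {R : ℝ} (hR : 0 < R) :
    meanEnergy f R = (maxBallDensity volume (energyMeasure f) R).toReal := by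
  have hball (a : ℂ) : ∫ z in Metric.ball a R, sphericalDeriv f z ^ 2 =
      (energyMeasure f (Metric.ball a R)).toReal := by
    rw [energyMeasure, withDensity_apply _ measurableSet_ball, integral_eq_lintegral_of_nonneg_ae
      (.of_forall fun z => sq_nonneg _) (hf.1.continuous_sphericalDeriv.pow 2).aestronglyMeasurable]
  have hfin (a : ℂ) : energyMeasure f (Metric.ball a R) ≠ ∞ :=
    ((hf.energyMeasure_le _).trans_lt measure_ball_lt_top).ne
  rw [meanEnergy, maxBallDensity, ENNReal.toReal_div, ENNReal.toReal_iSup hfin, Complex.volume_ball,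
    one_div_mul_eq_div]
  simp [hball, mul_comm, hR.le]

theorem IsBrodyCurve.tendsto_meanEnergy (hf : IsBrodyCurve f) :
    Tendsto (meanEnergy f) atTop (𝓝 (energyDensity f)) := by
  have hlim : ⨅ R : Set.Ioi (0 : ℝ), maxBallDensity volume (energyMeasure f) R ≠ ∞ :=
    ne_top_of_le_ne_top (hf.maxBallDensity_energyMeasure_ne_top 1)
      (iInf_le (fun R : Set.Ioi (0 : ℝ) => maxBallDensity volume (energyMeasure f) R)
        ⟨1, Set.mem_Ioi.2 one_pos⟩)
  have h := ((ENNReal.tendsto_toReal hlim).comp (tendsto_maxBallDensity _ _)).congr'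
    ((eventually_gt_atTop 0).mono fun R hR => (hf.meanEnergy_eq hR).symm)
  rwa [energyDensity, h.limUnder_eq]

theorem energyDensity_le_add (hf : IsBrodyCurve f) (hg : IsBrodyCurve g) {ε : ℝ} (hε : 0 ≤ ε)
    (h : ∀ z, sphericalDeriv f z ^ 2 ≤ sphericalDeriv g z ^ 2 + ε) :
    energyDensity f ≤ energyDensity g + ε := by
  refine le_of_tendsto_of_tendsto hf.tendsto_meanEnergy (hg.tendsto_meanEnergy.add_const ε) ?_
  filter_upwards [eventually_gt_atTop 0] with R hR
  have hle := maxBallDensity_le_add (energyMeasure_le_add hg.1 h) R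
  rw [hf.meanEnergy_eq hR, hg.meanEnergy_eq hR, ← ENNReal.toReal_ofReal hε,
    ← ENNReal.toReal_add (hg.maxBallDensity_energyMeasure_ne_top R) ENNReal.ofReal_ne_top]
  exact ENNReal.toReal_mono (ENNReal.add_ne_top.2
    ⟨hg.maxBallDensity_energyMeasure_ne_top R, ENNReal.ofReal_ne_top⟩) hle

end Energy

section GaussianLattice

theorem exists_norm_sub_gaussianInt_le (z : ℂ) : ∃ n : GaussianInt, ‖z - n‖ ≤ 3 / 4 := by
  refine ⟨⟨round z.re, round z.im⟩, abs_le_of_sq_le_sq' ?_ (by norm_num) |>.2⟩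
  have hround (x : ℝ) : (x - round x) ^ 2 ≤ (1 / 2) ^ 2 := sq_le_sq.2 (by
    simpa using abs_sub_round x)
  rw [← Complex.normSq_eq_norm_sq, Complex.normSq_apply, ← sq, ← sq, Complex.sub_re,
    Complex.sub_im, GaussianInt.re_toComplex, GaussianInt.im_toComplex]
  linarith [hround z.re, hround z.im]

theorem one_le_norm_gaussianInt {n : GaussianInt} (hn : n ≠ 0) : 1 ≤ ‖(n : ℂ)‖ := by
  rw [← sq_le_sq₀ zero_le_one (norm_nonneg _), one_pow, ← Complex.normSq_eq_norm_sq,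
    ← GaussianInt.intCast_real_norm]
  exact_mod_cast GaussianInt.norm_pos.2 hn

theorem summable_one_add_norm_gaussianInt_inv_pow :
    Summable fun n : GaussianInt => ((1 + ‖(n : ℂ)‖) ^ 3)⁻¹ := by
  let e : GaussianInt → Fin 2 → ℤ := fun n => ![n.re, n.im]
  have he : Function.Injective e := fun m n h =>
    Zsqrtd.ext (congrFun h 0) (congrFun h 1)
  refine ((EisensteinSeries.summable_one_div_norm_rpow
    (k := 3) (by norm_num)).comp_injective he).of_norm_bounded_eventually ?_
  filter_upwards [(Set.finite_singleton (0 : GaussianInt)).compl_mem_cofinite] with n hn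
  have hpos : 0 < ‖e n‖ := norm_pos_iff.2 fun h => hn (he (by
    simpa [e, funext_iff, Fin.forall_fin_two] using h))
  have hle : ‖e n‖ ≤ ‖(n : ℂ)‖ := (pi_norm_le_iff_of_nonneg (norm_nonneg _)).2 fun i => by
    fin_cases i
    · simpa [e, Int.norm_eq_abs] using Complex.abs_re_le_norm n
    · simpa [e, Int.norm_eq_abs] using Complex.abs_im_le_norm n
  rw [Function.comp_apply, Real.rpow_neg hpos.le, Real.norm_of_nonneg (by positivity)]
  norm_cast
  gcongr
  linarith

variable {M : ℝ}

theorem exists_norm_sub_mul_gaussianInt_le (hM : 0 < M) (z : ℂ) :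
    ∃ n : GaussianInt, ‖z - M * n‖ ≤ 3 / 4 * M := by
  obtain ⟨n, hn⟩ := exists_norm_sub_gaussianInt_le (z / M)
  have hscale : z - M * n = M * (z / M - n) := by
    rw [mul_sub, mul_div_cancel₀ _ (Complex.ofReal_ne_zero.2 hM.ne')]
  refine ⟨n, ?_⟩
  rw [hscale, norm_mul, Complex.norm_of_nonneg hM.le, mul_comm]
  gcongr

theorem norm_mul_gaussianInt_sub (hM : 0 ≤ M) (m n : GaussianInt) :
    ‖(M * m - M * n : ℂ)‖ = M * ‖((m - n : GaussianInt) : ℂ)‖ := by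
  rw [← mul_sub, ← GaussianInt.toComplex_sub, norm_mul, Complex.norm_of_nonneg hM]

theorem le_norm_sub_of_norm_sub_le {z : ℂ} {b n : GaussianInt} (hM : 0 ≤ M)
    (hz : ‖z - M * b‖ ≤ M / 2) (hn : n ≠ b) : M / 2 ≤ ‖z - M * n‖ := by
  have hsep : M ≤ ‖(M * b - M * n : ℂ)‖ := by
    rw [norm_mul_gaussianInt_sub hM]
    exact le_mul_of_one_le_right hM (one_le_norm_gaussianInt (sub_ne_zero.2 hn.symm))
  have htri := norm_sub_le_norm_sub_add_norm_sub (M * b : ℂ) z (M * n)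
  rw [norm_sub_rev _ z] at htri
  linarith

end GaussianLattice

section PoleSum

variable {V : Type*} [NormedAddCommGroup V] [NormedSpace ℂ V] {M C : ℝ} {P : Set GaussianInt}
  {B : GaussianInt → V} {z w : ℂ}

/-- The sum of the polar parts `(z - M n)⁻³ Bₙ` over the Gaussian integers `n ∈ P`. -/
noncomputable def poleSum (M : ℝ) (P : Set GaussianInt) (B : GaussianInt → V) (z : ℂ) : V :=
  ∑' n : P, ((z - M * (n : GaussianInt)) ^ 3)⁻¹ • B n

/-- A constant such that a `poleSum` with coefficients bounded by `C` is bounded by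
`C * poleSumConst / M ^ 3` at distance `M / 2` from its poles. -/
noncomputable def poleSumConst : ℝ :=
  9 ^ 3 * ∑' n : GaussianInt, ((1 + ‖(n : ℂ)‖) ^ 3)⁻¹

theorem norm_inv_pow_three_le {n₀ n : GaussianInt} (hM : 0 < M) (hn₀ : ‖w - M * n₀‖ ≤ M)
    (hn : M / 4 ≤ ‖w - M * n‖) :
    ‖((w - M * n) ^ 3)⁻¹‖ ≤ 9 ^ 3 / M ^ 3 * ((1 + ‖((n - n₀ : GaussianInt) : ℂ)‖) ^ 3)⁻¹ := by
  have htri := norm_sub_le (w - M * n₀) (w - M * n)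
  rw [sub_sub_sub_cancel_left, norm_mul_gaussianInt_sub hM.le] at htri
  have hle : M * (1 + ‖((n - n₀ : GaussianInt) : ℂ)‖) / 9 ≤ ‖w - M * n‖ := by linarith
  rw [norm_inv, norm_pow]
  calc (‖w - M * n‖ ^ 3)⁻¹ ≤ ((M * (1 + ‖((n - n₀ : GaussianInt) : ℂ)‖) / 9) ^ 3)⁻¹ := by gcongr
    _ = _ := by field_simp

theorem quarter_le_norm_sub {a : ℂ} (hz : M / 2 ≤ ‖z - a‖) (hw : w ∈ Metric.ball z (M / 4)) :
    M / 4 ≤ ‖w - a‖ := by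
  have htri := norm_sub_le_norm_sub_add_norm_sub z w a
  rw [norm_sub_rev z w] at htri
  linarith [mem_ball_iff_norm.1 hw]

theorem exists_summable_poleSum_bound (hM : 0 < M) (hC : 0 ≤ C) (hB : ∀ n ∈ P, ‖B n‖ ≤ C)
    (hz : ∀ n ∈ P, M / 2 ≤ ‖z - M * n‖) :
    ∃ U : P → ℝ, Summable U ∧ ∑' n, U n ≤ C * poleSumConst / M ^ 3 ∧
      ∀ n : P, ∀ w ∈ Metric.ball z (M / 4),
        ‖((w - M * (n : GaussianInt)) ^ 3)⁻¹ • B n‖ ≤ U n := by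
  obtain ⟨n₀, hn₀⟩ := exists_norm_sub_mul_gaussianInt_le hM z
  let W : GaussianInt → ℝ := fun n => ((1 + ‖((n - n₀ : GaussianInt) : ℂ)‖) ^ 3)⁻¹
  have hW : Summable W :=
    (Equiv.subRight n₀).summable_iff.2 summable_one_add_norm_gaussianInt_inv_pow
  have hW_tsum : ∑' n, W n = ∑' n : GaussianInt, ((1 + ‖(n : ℂ)‖) ^ 3)⁻¹ :=
    (Equiv.subRight n₀).tsum_eq fun n => ((1 + ‖(n : ℂ)‖) ^ 3)⁻¹
  refine ⟨fun n => 9 ^ 3 / M ^ 3 * W n * C, ((hW.subtype P).mul_left _).mul_right C, ?_,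
    fun n w hw => ?_⟩
  · calc ∑' n : P, 9 ^ 3 / M ^ 3 * W n * C = 9 ^ 3 / M ^ 3 * (∑' n : P, W n) * C := by
          rw [tsum_mul_right, tsum_mul_left]
      _ ≤ 9 ^ 3 / M ^ 3 * (∑' n, W n) * C := by
          gcongr
          exact hW.tsum_subtype_le W P fun n => by positivity
      _ = C * poleSumConst / M ^ 3 := by
          rw [hW_tsum, poleSumConst]
          ring
  · have hw₀ : ‖w - M * n₀‖ ≤ M := by
      linarith [norm_sub_le_norm_sub_add_norm_sub w z (M * n₀), mem_ball_iff_norm.1 hw]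
    exact (norm_smul_le _ _).trans (mul_le_mul
      (norm_inv_pow_three_le hM hw₀ (quarter_le_norm_sub (hz n n.2) hw)) (hB n n.2)
      (norm_nonneg _) (by positivity))

theorem norm_poleSum_le (hM : 0 < M) (hC : 0 ≤ C) (hB : ∀ n ∈ P, ‖B n‖ ≤ C)
    (hz : ∀ n ∈ P, M / 2 ≤ ‖z - M * n‖) (hw : w ∈ Metric.ball z (M / 4)) :
    ‖poleSum M P B w‖ ≤ C * poleSumConst / M ^ 3 := by
  obtain ⟨U, hU, hU_le, hbound⟩ := exists_summable_poleSum_bound hM hC hB hz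
  exact (tsum_of_norm_bounded hU.hasSum fun n => hbound n w hw).trans hU_le

variable [CompleteSpace V]

theorem poleSum_eq_add {b : GaussianInt} (hM : 0 < M) (hC : 0 ≤ C) (hB : ∀ n ∈ P, ‖B n‖ ≤ C)
    (hb : b ∈ P) (hz : ∀ n ∈ P \ {b}, M / 2 ≤ ‖z - M * n‖) (hw : w ∈ Metric.ball z (M / 4)) :
    poleSum M P B w = ((w - M * b) ^ 3)⁻¹ • B b + poleSum M (P \ {b}) B w := by
  obtain ⟨U, hU, -, hbound⟩ := exists_summable_poleSum_bound hM hC (fun n hn => hB n hn.1) hz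
  let term : GaussianInt → V := fun n => ((w - M * n) ^ 3)⁻¹ • B n
  have hsplit := Summable.tsum_union_disjoint (f := term) (Set.disjoint_sdiff_right (s := {b}))
    .of_finite (hU.of_norm_bounded fun n => hbound n w hw)
  rwa [Set.union_sdiff_cancel (Set.singleton_subset_iff.2 hb), tsum_singleton] at hsplit

theorem differentiableOn_poleSum (hM : 0 < M) (hC : 0 ≤ C) (hB : ∀ n ∈ P, ‖B n‖ ≤ C)
    (hz : ∀ n ∈ P, M / 2 ≤ ‖z - M * n‖) :
    DifferentiableOn ℂ (poleSum M P B) (Metric.ball z (M / 4)) := by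
  obtain ⟨U, hU, -, hbound⟩ := exists_summable_poleSum_bound hM hC hB hz
  refine Complex.differentiableOn_tsum_of_summable_norm hU (fun n w hw => ?_)
    Metric.isOpen_ball hbound
  have hw0 : w - M * (n : GaussianInt) ≠ 0 := norm_pos_iff.1 <|
    (by positivity : 0 < M / 4).trans_le (quarter_le_norm_sub (hz n n.2) hw)
  have hdiff : DifferentiableAt ℂ (fun w : ℂ => ((w - M * (n : GaussianInt)) ^ 3)⁻¹ • B n) w := by
    fun_prop (disch := simpa using hw0)
  exact hdiff.differentiableWithinAt

theorem analyticAt_poleSum (hM : 0 < M) (hC : 0 ≤ C) (hB : ∀ n ∈ P, ‖B n‖ ≤ C)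
    (hz : ∀ n ∈ P, M / 2 ≤ ‖z - M * n‖) : AnalyticAt ℂ (poleSum M P B) z :=
  (differentiableOn_poleSum hM hC hB hz).analyticAt (Metric.ball_mem_nhds z (by positivity))

theorem norm_deriv_poleSum_le (hM : 0 < M) (hC : 0 ≤ C) (hB : ∀ n ∈ P, ‖B n‖ ≤ C)
    (hz : ∀ n ∈ P, M / 2 ≤ ‖z - M * n‖) :
    ‖deriv (poleSum M P B) z‖ ≤ C * poleSumConst / M ^ 3 / (M / 8) := by
  have hsub : Metric.closedBall z (M / 8) ⊆ Metric.ball z (M / 4) :=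
    Metric.closedBall_subset_ball (by linarith)
  refine Complex.norm_deriv_le_of_forall_mem_sphere_norm_le (by positivity)
    ((differentiableOn_poleSum hM hC hB hz).mono ?_).diffContOnCl fun w hw =>
      norm_poleSum_le hM hC hB hz (hsub (Metric.sphere_subset_closedBall hw))
  exact Metric.closure_ball_subset_closedBall.trans hsub

end PoleSum

section BubbleEstimates

variable {N : ℕ} {f g : ℂ → CP N} {z : ℂ} {F X : ℂ → EuclideanSpace ℂ (Fin (N + 1))}

theorem one_le_sqrt_pi : 1 ≤ √Real.pi :=
  Real.one_le_sqrt.2 (by linarith [Real.pi_gt_three])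

theorem sqrt_pi_le_two : √Real.pi ≤ 2 :=
  Real.sqrt_le_iff.2 ⟨by norm_num, by linarith [Real.pi_le_four]⟩

theorem analyticAt_add_clm_apply {E : Type*} [NormedAddCommGroup E] [NormedSpace ℂ E]
    {S : ℂ → E →L[ℂ] E} {F : ℂ → E} (hS : AnalyticAt ℂ S z) (hF : AnalyticAt ℂ F z) :
    AnalyticAt ℂ (fun w => F w + S w (F w)) z :=
  hF.add (((ContinuousLinearMap.id ℂ (E →L[ℂ] E)).analyticAt_bilinear (S z, F z)).comp₂ hS hF)

theorem deriv_add_clm_apply {E : Type*} [NormedAddCommGroup E] [NormedSpace ℂ E]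
    {S : ℂ → E →L[ℂ] E} {F : ℂ → E} (hS : DifferentiableAt ℂ S z) (hF : DifferentiableAt ℂ F z) :
    deriv (fun w => F w + S w (F w)) z = deriv F z + (deriv S z (F z) + S z (deriv F z)) :=
  (hF.hasDerivAt.add (hS.hasDerivAt.clm_apply hF.hasDerivAt)).deriv

theorem abs_sphericalDeriv_sub_le
    {S : ℂ → EuclideanSpace ℂ (Fin (N + 1)) →L[ℂ] EuclideanSpace ℂ (Fin (N + 1))} {η : ℝ}
    (hη : η ≤ 1 / 2) (hS : AnalyticAt ℂ S z) (hSz : ‖S z‖ ≤ η) (hS' : ‖deriv S z‖ ≤ η)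
    (hF : IsLocalLift f z F) (hg : IsLocalLift g z (fun w => F w + S w (F w)))
    (hf : sphericalDeriv f z ≤ 1) : |sphericalDeriv g z - sphericalDeriv f z| ≤ 10 * η := by
  rw [sphericalDeriv_eq_fsDeriv hF, div_le_one (by positivity)] at hf
  have hfs := abs_fsDeriv_clm_sub_fsDeriv_le hF.ne_zero hη hSz hS' (hf.trans sqrt_pi_le_two)
  rw [sphericalDeriv_eq_fsDeriv hF, sphericalDeriv_eq_fsDeriv hg,
    deriv_add_clm_apply hS.differentiableAt hF.1.differentiableAt, ← sub_div, abs_div,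
    abs_of_nonneg (Real.sqrt_nonneg _)]
  exact (div_le_self (abs_nonneg _) one_le_sqrt_pi).trans hfs

theorem hasDerivAt_bubble (b z : ℂ) :
    HasDerivAt (fun w : ℂ => ((w - b) / 6) ^ 3) (((z - b) / 6) ^ 2 / 2) z := by
  refine ((((hasDerivAt_id z).sub_const b).div_const 6).pow 3).congr_deriv ?_
  simp only [id_eq]
  ring

theorem norm_deriv_bubble_div_le (ζ : ℂ) : ‖ζ ^ 2 / 2‖ / (1 + ‖ζ ^ 3‖ ^ 2) ≤ 1 / 2 := by
  have hpow : ‖ζ‖ ^ 2 ≤ 1 + (‖ζ‖ ^ 3) ^ 2 := by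
    nlinarith [sq_nonneg (‖ζ‖ ^ 2 - 1), sq_nonneg ‖ζ‖, sq_nonneg (‖ζ‖ * (‖ζ‖ ^ 2 - 1))]
  rw [norm_div, norm_pow, norm_pow, Complex.norm_ofNat, div_le_iff₀ (by positivity)]
  linarith

theorem sphericalDeriv_bubble {v u : EuclideanSpace ℂ (Fin (N + 1))} {b : ℂ} (hv : ‖v‖ = 1)
    (hu : ‖u‖ = 1) (hvu : inner ℂ v u = 0) (hX : AnalyticAt ℂ X z) (hXv : ‖X z - v‖ ≤ 3 / 20)
    (hX' : ‖deriv X z‖ ≤ 1 / 10)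
    (hg : IsLocalLift g z (fun w => ((w - b) / 6) ^ 3 • X w + u)) :
    sphericalDeriv g z ≤ 4 / 5 ∧ (‖z - b‖ = 6 → 1 / 40 ≤ sphericalDeriv g z) := by
  obtain ⟨hupper, hlower⟩ := fsDeriv_smul_add_bounds (a := ((z - b) / 6) ^ 3)
    (a' := ((z - b) / 6) ^ 2 / 2) hv hu hvu (by norm_num) hXv hX'
  have hderiv : deriv (fun w => ((w - b) / 6) ^ 3 • X w + u) z =
      (((z - b) / 6) ^ 2 / 2) • X z + ((z - b) / 6) ^ 3 • deriv X z :=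
    (((hasDerivAt_bubble b z).fun_smul hX.differentiableAt.hasDerivAt).add_const u).deriv.trans
      (add_comm _ _)
  rw [sphericalDeriv_eq_fsDeriv hg, hderiv]
  refine ⟨(div_le_self (fsDeriv_nonneg _ _) one_le_sqrt_pi).trans ?_, fun hz => ?_⟩
  · linarith [norm_deriv_bubble_div_le ((z - b) / 6)]
  · have hζ : ‖(z - b) / 6‖ = 1 := by rw [norm_div, hz, Complex.norm_ofNat, div_self (by norm_num)]
    rw [norm_div, norm_pow, norm_pow, hζ, Complex.norm_ofNat] at hlower
    rw [le_div_iff₀ (by positivity)]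
    linarith [sqrt_pi_le_two]

theorem exists_isLocalLift_normalized (hf : IsHolomorphic f)
    {v : EuclideanSpace ℂ (Fin (N + 1))} (hv : ‖v‖ = 1) (hcos : 199 / 200 ≤ cosSq v (f z))
    (hd : sphericalDeriv f z ≤ 1 / 4000) :
    ∃ F, IsLocalLift f z F ∧ (∀ᶠ w in 𝓝 z, inner ℂ v (F w) = 1) ∧ ‖F z - v‖ ≤ 1 / 10 ∧
      ‖F z‖ ≤ 101 / 100 ∧ ‖deriv F z‖ ≤ 1 / 100 := by
  obtain ⟨F₀, hF₀⟩ := hf z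
  have h0 : inner ℂ v (F₀ z) ≠ 0 := fun h0 => by
    rw [← hF₀.2.self_of_nhds.2, cosSq_mk, h0] at hcos
    norm_num at hcos
  have hF := hF₀.inv_inner_smul h0
  let F : ℂ → EuclideanSpace ℂ (Fin (N + 1)) := fun w => (inner ℂ v (F₀ w))⁻¹ • F₀ w
  have hinner : ∀ᶠ w in 𝓝 z, inner ℂ v (F w) = 1 := by
    filter_upwards [(continuousAt_const.inner hF₀.1.continuousAt).eventually_ne h0] with w hw
    rw [inner_smul_right, inv_mul_cancel₀ hw]
  have hinner' : inner ℂ v (deriv F z) = 0 := by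
    have hcomp := (innerSL ℂ v).hasFDerivAt.comp_hasDerivAt z hF.1.differentiableAt.hasDerivAt
    rw [← innerSL_apply_apply, ← hcomp.deriv]
    exact (EventuallyEq.deriv_eq hinner).trans (deriv_const z (1 : ℂ))
  have hFz := hinner.self_of_nhds
  have hnorm_sq : ‖F z‖ ^ 2 ≤ 101 / 100 := by
    rw [← hF.2.self_of_nhds.2, cosSq_mk, hFz, norm_one,
      le_div_iff₀ (pow_pos (norm_pos_iff.2 hF.ne_zero) 2)] at hcos
    linarith
  have hnorm : ‖F z‖ ≤ 101 / 100 := by nlinarith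
  refine ⟨F, hF, hinner, ?_, hnorm, ?_⟩
  · nlinarith [norm_sub_sq_of_inner_eq_one hv hFz]
  · rw [sphericalDeriv_eq_fsDeriv hF, div_le_iff₀ (by positivity)] at hd
    have hfs : fsDeriv (F z) (deriv F z) ≤ 1 / 2000 := hd.trans (by linarith [sqrt_pi_le_two])
    calc ‖deriv F z‖ ≤ fsDeriv (F z) (deriv F z) * (‖F z‖ + ‖F z‖ ^ 2) :=
          norm_le_fsDeriv_mul hv hFz hinner'
      _ ≤ 1 / 2000 * (101 / 100 + 101 / 100) := by gcongr
      _ ≤ 1 / 100 := by norm_num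

end BubbleEstimates

section Gluing

theorem exists_unit_orthogonal {E : Type*} [NormedAddCommGroup E] [InnerProductSpace ℂ E]
    [FiniteDimensional ℂ E] (hE : 1 < Module.finrank ℂ E) (v : E) :
    ∃ u : E, ‖u‖ = 1 ∧ inner ℂ v u = 0 := by
  have hsum := (Submodule.span ℂ {v}).finrank_add_finrank_orthogonal
  have hspan : Module.finrank ℂ (Submodule.span ℂ {v}) ≤ 1 := by
    simpa using finrank_span_le_card (R := ℂ) {v}
  have : Nontrivial (Submodule.span ℂ {v})ᗮ := Module.nontrivial_of_finrank_pos (R := ℂ) (by omega)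
  obtain ⟨u, hu⟩ := exists_norm_eq (Submodule.span ℂ {v})ᗮ zero_le_one
  exact ⟨u, hu, Submodule.mem_orthogonal_singleton_iff_inner_right.1 u.2⟩

variable {N : ℕ} {f g : ℂ → CP N} {M η : ℝ} {P : Set GaussianInt} {z : ℂ}
  {F : ℂ → EuclideanSpace ℂ (Fin (N + 1))}

/-- Orthonormal pairs of vectors, one for each point of the lattice `M ℤ[i]`; the first vector
spans the line given by `f` at that lattice point. -/
structure LatticeFrame (f : ℂ → CP N) (M : ℝ) where
  v : GaussianInt → EuclideanSpace ℂ (Fin (N + 1))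
  u : GaussianInt → EuclideanSpace ℂ (Fin (N + 1))
  norm_v : ∀ n, ‖v n‖ = 1
  norm_u : ∀ n, ‖u n‖ = 1
  inner_eq_zero : ∀ n, inner ℂ (v n) (u n) = 0
  mk_v : ∀ n, ∃ h, Projectivization.mk ℂ (v n) h = f (M * n)

theorem nonempty_latticeFrame (hN : 1 ≤ N) (f : ℂ → CP N) (M : ℝ) :
    Nonempty (LatticeFrame f M) := by
  have hunit (p : CP N) : ∃ v : EuclideanSpace ℂ (Fin (N + 1)),
      ‖v‖ = 1 ∧ ∃ h, Projectivization.mk ℂ v h = p := by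
    have hnorm := norm_smul_inv_norm (𝕜 := ℂ) p.rep_nonzero
    refine ⟨_, hnorm, norm_ne_zero_iff.1 (by rw [hnorm]; exact one_ne_zero), ?_⟩
    conv_rhs => rw [← p.mk_rep]
    exact (Projectivization.mk_eq_mk_iff' ℂ _ _ _ _).2 ⟨_, rfl⟩
  choose v hv hv_mk using hunit
  choose u hu huv using fun v : EuclideanSpace ℂ (Fin (N + 1)) =>
    exists_unit_orthogonal (by rw [finrank_euclideanSpace_fin]; omega) v
  exact ⟨⟨fun n => v (f (M * n)), fun n => u (v (f (M * n))), fun _ => hv _, fun _ => hu _,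
    fun _ => huv _, fun _ => hv_mk _⟩⟩

/-- The Gaussian integers `n` such that `|df| ≤ δ` on the disk of radius `M / 2` around `M n`. -/
def flatIndices (f : ℂ → CP N) (M δ : ℝ) : Set GaussianInt :=
  {n | ∀ w ∈ Metric.closedBall (M * n : ℂ) (M / 2), sphericalDeriv f w ≤ δ}

/-- A homogeneous coordinate vector of the map `f + S f`, for an operator-valued function `S`. -/
noncomputable def perturbedRep (f : ℂ → CP N)
    (S : ℂ → EuclideanSpace ℂ (Fin (N + 1)) →L[ℂ] EuclideanSpace ℂ (Fin (N + 1))) (w : ℂ) :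
    EuclideanSpace ℂ (Fin (N + 1)) :=
  (f w).rep + S w (f w).rep

theorem IsLocalLift.eventually_eq_smul_perturbedRep (hF : IsLocalLift f z F)
    (S : ℂ → EuclideanSpace ℂ (Fin (N + 1)) →L[ℂ] EuclideanSpace ℂ (Fin (N + 1))) :
    ∀ᶠ w in 𝓝 z, ∃ c : ℂ, F w + S w (F w) = c • perturbedRep f S w := by
  filter_upwards [hF.2] with w ⟨hFw, hfw⟩
  obtain ⟨a, ha⟩ := Projectivization.exists_smul_eq_mk_rep ℂ (F w) hFw
  refine ⟨(a⁻¹ : ℂˣ), ?_⟩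
  rw [perturbedRep, ← hfw, ← ha, Units.smul_def, map_smul, ← smul_add, smul_smul, Units.inv_mul,
    one_smul]

namespace LatticeFrame

variable (D : LatticeFrame f M)

/-- The meromorphic operator `∑ₙ (6 / (z - M n))³ ⟨vₙ, ·⟩ uₙ`, summed over `n ∈ P`. -/
noncomputable def gluing (P : Set GaussianInt) :
    ℂ → EuclideanSpace ℂ (Fin (N + 1)) →L[ℂ] EuclideanSpace ℂ (Fin (N + 1)) :=
  poleSum M P fun n => (6 ^ 3 : ℂ) • InnerProductSpace.rankOne ℂ (D.u n) (D.v n)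

theorem norm_polar_le (n : GaussianInt) :
    ‖(6 ^ 3 : ℂ) • InnerProductSpace.rankOne ℂ (D.u n) (D.v n)‖ ≤ 6 ^ 3 := by
  simp [norm_smul, D.norm_u, D.norm_v]

theorem gluing_eq_add {b : GaussianInt} (hM : 0 < M) (hb : b ∈ P)
    (hz : ∀ n ∈ P \ {b}, M / 2 ≤ ‖z - M * n‖) {w : ℂ} (hw : w ∈ Metric.ball z (M / 4))
    (x : EuclideanSpace ℂ (Fin (N + 1))) :
    D.gluing P w x =
      ((6 / (w - M * b)) ^ 3 * inner ℂ (D.v b) x) • D.u b + D.gluing (P \ {b}) w x := by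
  rw [gluing, poleSum_eq_add hM (by norm_num) (fun n _ => D.norm_polar_le n) hb hz hw,
    add_apply, smul_apply, smul_apply, InnerProductSpace.rankOne_apply, smul_smul, smul_smul,
    div_pow, div_eq_inv_mul]
  rfl

theorem gluing_estimates (hM : 8 ≤ M) (hη : 6 ^ 3 * poleSumConst / M ^ 3 ≤ η)
    (hz : ∀ n ∈ P, M / 2 ≤ ‖z - M * n‖) :
    AnalyticAt ℂ (D.gluing P) z ∧ ‖D.gluing P z‖ ≤ η ∧ ‖deriv (D.gluing P) z‖ ≤ η := by
  have hM0 : 0 < M := by linarith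
  have hC : (0 : ℝ) ≤ 6 ^ 3 := by norm_num
  have hB : ∀ n ∈ P, _ := fun n _ => D.norm_polar_le n
  have hle := norm_poleSum_le hM0 hC hB hz (Metric.mem_ball_self (by positivity))
  refine ⟨analyticAt_poleSum hM0 hC hB hz, hle.trans hη, ?_⟩
  refine (norm_deriv_poleSum_le hM0 hC hB hz).trans (le_trans ?_ hη)
  exact div_le_self ((norm_nonneg _).trans hle) (by linarith)

theorem isPuncturedLift_far (hS : AnalyticAt ℂ (D.gluing P) z) (hSz : ‖D.gluing P z‖ ≤ 1 / 2)
    (hF : IsLocalLift f z F) :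
    IsPuncturedLift (perturbedRep f (D.gluing P)) z (fun w => F w + D.gluing P w (F w)) where
  analyticAt := analyticAt_add_clm_apply hS hF.1
  ne_zero := by
    have hle := le_norm_add_of_norm_le ((D.gluing P z).le_of_opNorm_le hSz (F z))
    exact norm_pos_iff.1 (by linarith [norm_pos_iff.2 hF.ne_zero])
  eventually_eq_smul := (hF.eventually_eq_smul_perturbedRep _).filter_mono nhdsWithin_le_nhds

theorem cosSq_ge_of_mem_flatIndices {b : GaussianInt} (hf : IsHolomorphic f) (hM : 0 < M)
    (hb : b ∈ flatIndices f M (1 / (400 * M))) (hz : ‖z - M * b‖ ≤ M / 2) :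
    199 / 200 ≤ cosSq (D.v b) (f z) := by
  obtain ⟨hv, hvf⟩ := D.mk_v b
  have hlip := abs_cosSq_sub_le hf (D.norm_v b) hb (mem_closedBall_iff_norm.2 hz)
  have hcenter : cosSq (D.v b) (f (M * b)) = 1 := by
    rw [← hvf, cosSq_mk, inner_self_eq_norm_sq_to_K, D.norm_v]
    norm_num
  have hsmall : 2 * √Real.pi * (1 / (400 * M)) * ‖z - M * b‖ ≤ 1 / 200 := by
    calc _ ≤ 2 * 2 * (1 / (400 * M)) * (M / 2) := by gcongr; exact sqrt_pi_le_two
      _ = 1 / 200 := by field_simp; norm_num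
  linarith [(abs_le.1 (hlip.trans hsmall)).1]

theorem isPuncturedLift_near {b : GaussianInt} (hM : 0 < M) (hb : b ∈ P)
    (hz : ∀ n ∈ P \ {b}, M / 2 ≤ ‖z - M * n‖) (hS : AnalyticAt ℂ (D.gluing (P \ {b})) z)
    (hF : IsLocalLift f z F) (hvF : ∀ᶠ w in 𝓝 z, inner ℂ (D.v b) (F w) = 1)
    (hX : ‖F z + D.gluing (P \ {b}) z (F z) - D.v b‖ ≤ 3 / 20) :
    IsPuncturedLift (perturbedRep f (D.gluing P)) z (fun w =>
      ((w - M * b) / 6) ^ 3 • (F w + D.gluing (P \ {b}) w (F w)) + D.u b) where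
  analyticAt := by
    have hX := analyticAt_add_clm_apply hS hF.1
    fun_prop
  ne_zero := smul_add_ne_zero (D.norm_v b) (D.norm_u b) (D.inner_eq_zero b) (by norm_num) hX _
  eventually_eq_smul := by
    have hne : ∀ᶠ w : ℂ in 𝓝[≠] z, w ≠ M * b :=
      nhdsNE_le_cofinite z (Set.finite_singleton (M * b : ℂ)).compl_mem_cofinite
    filter_upwards [hne, (hF.eventually_eq_smul_perturbedRep (D.gluing P)).filter_mono
      nhdsWithin_le_nhds, hvF.filter_mono nhdsWithin_le_nhds,
      mem_nhdsWithin_of_mem_nhds (Metric.ball_mem_nhds z (by positivity : 0 < M / 4))]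
      with w hwb ⟨c, hc⟩ hvw hw
    refine ⟨((w - M * b) / 6) ^ 3 * c, ?_⟩
    have hpole : ((w - M * b) / 6) ^ 3 * (6 / (w - M * b)) ^ 3 = 1 := by
      rw [← mul_pow, div_mul_div_cancel₀' (sub_ne_zero.2 hwb)]
      norm_num
    rw [mul_smul, ← hc, D.gluing_eq_add hM hb hz hw, hvw, mul_one]
    linear_combination (norm := module) (-hpole) • D.u b

theorem exists_isPuncturedLift_near {b : GaussianInt} (hf : IsHolomorphic f) (hM : 12 ≤ M)
    (hη : 6 ^ 3 * poleSumConst / M ^ 3 ≤ η) (hη' : η ≤ 1 / 100)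
    (hP : P ⊆ flatIndices f M (1 / (400 * M))) (hb : b ∈ P) (hz : ‖z - M * b‖ ≤ M / 2) :
    ∃ X, AnalyticAt ℂ X z ∧ ‖X z - D.v b‖ ≤ 3 / 20 ∧ ‖deriv X z‖ ≤ 1 / 10 ∧
      IsPuncturedLift (perturbedRep f (D.gluing P)) z
        (fun w => ((w - M * b) / 6) ^ 3 • X w + D.u b) := by
  have hM0 : 0 < M := by linarith
  have hsmall : sphericalDeriv f z ≤ 1 / 4000 := by
    refine (hP hb z (mem_closedBall_iff_norm.2 hz)).trans ?_
    gcongr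
    linarith
  obtain ⟨F, hF, hvF, hFv, hFz, hF'⟩ := exists_isLocalLift_normalized hf (D.norm_v b)
    (D.cosSq_ge_of_mem_flatIndices hf hM0 (hP hb) hz) hsmall
  have hz' : ∀ n ∈ P \ {b}, M / 2 ≤ ‖z - M * n‖ :=
    fun n hn => le_norm_sub_of_norm_sub_le hM0.le hz hn.2
  obtain ⟨hS, hSz, hS'⟩ := D.gluing_estimates (by linarith) hη hz'
  have hSF := (D.gluing (P \ {b}) z).le_of_opNorm_le_of_le (hSz.trans hη') hFz
  have hS'F := (deriv (D.gluing (P \ {b})) z).le_of_opNorm_le_of_le (hS'.trans hη') hFz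
  have hSF' := (D.gluing (P \ {b}) z).le_of_opNorm_le_of_le (hSz.trans hη') hF'
  have hX : ‖F z + D.gluing (P \ {b}) z (F z) - D.v b‖ ≤ 3 / 20 := by
    rw [add_sub_right_comm]
    linarith [norm_add_le_of_le hFv hSF]
  refine ⟨_, analyticAt_add_clm_apply hS hF.1, hX, ?_,
    D.isPuncturedLift_near hM0 hb hz' hS hF hvF hX⟩
  rw [deriv_add_clm_apply hS.differentiableAt hF.1.differentiableAt]
  linarith [norm_add_le_of_le hF' (norm_add_le_of_le hS'F hSF')]

end LatticeFrame

/-- The main features of a curve `g` obtained from `f` by gluing in a copy of a fixed rational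
curve at each lattice point `M n` with `n ∈ P`: its derivative is under control near these points,
and within `10 * η` of that of `f` away from them. -/
structure IsBubbling (f g : ℂ → CP N) (M : ℝ) (P : Set GaussianInt) (η : ℝ) : Prop where
  isHolomorphic : IsHolomorphic g
  abs_sub_le_of_far : ∀ z : ℂ, (∀ n ∈ P, M / 2 ≤ ‖z - M * n‖) →
    |sphericalDeriv g z - sphericalDeriv f z| ≤ 10 * η
  le_of_near : ∀ b ∈ P, ∀ z : ℂ, ‖z - M * b‖ ≤ M / 2 → sphericalDeriv g z ≤ 4 / 5
  ge_on_circle : ∀ b ∈ P, ∀ z : ℂ, ‖z - M * b‖ = 6 → 1 / 40 ≤ sphericalDeriv g z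

theorem exists_isBubbling (hN : 1 ≤ N) (hf : IsBrodyCurve f) (hM : 12 ≤ M)
    (hη : 6 ^ 3 * poleSumConst / M ^ 3 ≤ η) (hη' : η ≤ 1 / 100)
    (hP : P ⊆ flatIndices f M (1 / (400 * M))) : ∃ g, IsBubbling f g M P η := by
  obtain ⟨D⟩ := nonempty_latticeFrame hN f M
  have hest {z : ℂ} := D.gluing_estimates (z := z) (P := P) (by linarith) hη
  have hfar {z : ℂ} (hz : ∀ n ∈ P, M / 2 ≤ ‖z - M * n‖) {F} (hF : IsLocalLift f z F) :=
    D.isPuncturedLift_far (hest hz).1 ((hest hz).2.1.trans (by linarith)) hF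
  have hnear {z : ℂ} {b : GaussianInt} :=
    D.exists_isPuncturedLift_near (z := z) (b := b) hf.1 hM hη hη' hP
  have hlift (z : ℂ) : ∃ G, IsPuncturedLift (perturbedRep f (D.gluing P)) z G := by
    by_cases hz : ∀ n ∈ P, M / 2 ≤ ‖z - M * n‖
    · obtain ⟨F, hF⟩ := hf.1 z
      exact ⟨_, hfar hz hF⟩
    · push Not at hz
      obtain ⟨b, hb, hzb⟩ := hz
      obtain ⟨X, -, -, -, hG⟩ := hnear hb hzb.le
      exact ⟨_, hG⟩
  obtain ⟨g, hg⟩ := exists_isLocalLift_of_isPuncturedLift hlift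
  have hbubble {z : ℂ} {b : GaussianInt} (hb : b ∈ P) (hz : ‖z - M * b‖ ≤ M / 2) :
      sphericalDeriv g z ≤ 4 / 5 ∧ (‖z - M * b‖ = 6 → 1 / 40 ≤ sphericalDeriv g z) := by
    obtain ⟨X, hX, hXv, hX', hG⟩ := hnear hb hz
    exact sphericalDeriv_bubble (D.norm_v b) (D.norm_u b) (D.inner_eq_zero b) hX hXv hX'
      (hg z _ hG)
  refine ⟨g, fun z => ?_, fun z hz => ?_, fun b hb z hz => (hbubble hb hz).1,
    fun b hb z hz => (hbubble hb (by linarith)).2 hz⟩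
  · obtain ⟨G, hG⟩ := hlift z
    exact ⟨G, hg z G hG⟩
  · obtain ⟨F, hF⟩ := hf.1 z
    obtain ⟨hS, hSz, hS'⟩ := hest hz
    exact abs_sphericalDeriv_sub_le (by linarith) hS hSz hS' hF (hg z _ (hfar hz hF)) (hf.2 z)

end Gluing

section Conclusion

variable {N : ℕ} {f g : ℂ → CP N} {M η : ℝ} {P : Set GaussianInt} {D : Set ℂ} {z : ℂ}

theorem sphericalDeriv_le_toReal_derivSupNorm (hD : derivSupNorm f D ≠ ∞) (hz : z ∈ D) :
    sphericalDeriv f z ≤ (derivSupNorm f D).toReal :=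
  (ENNReal.ofReal_le_iff_le_toReal hD).1
    (le_iSup₂ (f := fun z (_ : z ∈ D) => ENNReal.ofReal (sphericalDeriv f z)) z hz)

theorem derivSupNorm_le {s : ℝ} (hs : ∀ z ∈ D, sphericalDeriv f z ≤ s) :
    derivSupNorm f D ≤ ENNReal.ofReal s :=
  iSup₂_le fun z hz => ENNReal.ofReal_le_ofReal (hs z hz)

theorem le_derivSupNorm {c : ℝ} (hz : z ∈ D) (hc : c ≤ sphericalDeriv f z) :
    ENNReal.ofReal c ≤ derivSupNorm f D :=
  le_iSup₂_of_le z hz (ENNReal.ofReal_le_ofReal hc)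

namespace IsBubbling

theorem far_or_near (hfg : IsBubbling f g M P η) (z : ℂ) :
    |sphericalDeriv g z - sphericalDeriv f z| ≤ 10 * η ∨ ∃ b ∈ P, ‖z - M * b‖ ≤ M / 2 := by
  by_cases hz : ∀ n ∈ P, M / 2 ≤ ‖z - M * n‖
  · exact .inl (hfg.abs_sub_le_of_far z hz)
  · push Not at hz
    exact .inr (hz.imp fun b hb => ⟨hb.1, hb.2.le⟩)

theorem sphericalDeriv_le (hfg : IsBubbling f g M P η) {s : ℝ}
    (hs : ∀ z, sphericalDeriv f z ≤ s) (z : ℂ) : sphericalDeriv g z ≤ max (s + 10 * η) (4 / 5) := by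
  obtain hz | ⟨b, hb, hz⟩ := hfg.far_or_near z
  · exact le_max_of_le_left (by linarith [(abs_le.1 hz).2, hs z])
  · exact le_max_of_le_right (hfg.le_of_near b hb z hz)

theorem sphericalDeriv_sq_le (hfg : IsBubbling f g M P η) {δ ε : ℝ} (hP : P ⊆ flatIndices f M δ)
    (hf : ∀ z, sphericalDeriv f z ≤ 1) (hg : ∀ z, sphericalDeriv g z ≤ 1) (hδ : δ ≤ ε)
    (hη : 20 * η ≤ ε) (z : ℂ) : sphericalDeriv f z ^ 2 ≤ sphericalDeriv g z ^ 2 + ε := by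
  have hf0 := sphericalDeriv_nonneg f z
  have hg0 := sphericalDeriv_nonneg g z
  obtain hz | ⟨b, hb, hz⟩ := hfg.far_or_near z
  · calc sphericalDeriv f z ^ 2
      _ = sphericalDeriv g z ^ 2 + (sphericalDeriv f z - sphericalDeriv g z) *
            (sphericalDeriv f z + sphericalDeriv g z) := by ring
      _ ≤ sphericalDeriv g z ^ 2 + 10 * η * 2 := by
          gcongr
          · exact (abs_nonneg _).trans hz
          · linarith [(abs_le.1 hz).1]
          · linarith [hf z, hg z]
      _ ≤ sphericalDeriv g z ^ 2 + ε := by linarith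
  · have hfz : sphericalDeriv f z ≤ δ := hP hb z (mem_closedBall_iff_norm.2 hz)
    nlinarith [hf z, sq_nonneg (sphericalDeriv g z)]

theorem isNondegenerateBrodyCurve {δ : ℝ} (hfg : IsBubbling f g M (flatIndices f M δ) η)
    (hM : 12 ≤ M) (hδ : 0 < δ) (hη : 20 * η ≤ δ) (hg : ∀ z, sphericalDeriv g z ≤ 1) :
    IsNondegenerateBrodyCurve g := by
  refine ⟨⟨hfg.isHolomorphic, hg⟩, min (1 / 40) (δ / 2), by positivity, 2 * M, by positivity,
    fun a => ?_⟩
  obtain ⟨n, hn⟩ := exists_norm_sub_mul_gaussianInt_le (by linarith : 0 < M) a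
  rw [norm_sub_rev] at hn
  suffices h : ∃ z : ℂ, ‖z - M * n‖ ≤ M / 2 ∧ min (1 / 40) (δ / 2) ≤ sphericalDeriv g z by
    obtain ⟨z, hzn, hz⟩ := h
    refine le_derivSupNorm (mem_closedBall_iff_norm.2 ?_) hz
    linarith [norm_sub_le_norm_sub_add_norm_sub z (M * n) a]
  by_cases hflat : n ∈ flatIndices f M δ
  · have h6 : ‖(M * n + 6 - M * n : ℂ)‖ = 6 := by rw [add_sub_cancel_left, Complex.norm_ofNat]
    exact ⟨M * n + 6, by linarith, min_le_of_left_le (hfg.ge_on_circle n hflat _ h6)⟩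
  · obtain ⟨w, hw, hδw⟩ : ∃ w ∈ Metric.closedBall (M * n : ℂ) (M / 2), δ < sphericalDeriv f w := by
      simpa [flatIndices] using hflat
    refine ⟨w, mem_closedBall_iff_norm.1 hw, min_le_of_right_le ?_⟩
    obtain hfar | ⟨b, hb, hwb⟩ := hfg.far_or_near w
    · linarith [(abs_le.1 hfar).1]
    · exact absurd (hb w (mem_closedBall_iff_norm.2 hwb)) hδw.not_ge

end IsBubbling

theorem exists_spacing (K : ℝ) {τ : ℝ} (hτ : 0 < τ) :
    ∃ M : ℝ, 12 ≤ M ∧ 20 * (K / M ^ 3) ≤ 1 / (400 * M) ∧ 1 / (400 * M) ≤ τ := by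
  obtain ⟨M, hM, hMK, hMτ⟩ := ((eventually_ge_atTop (12 : ℝ)).and
    (((tendsto_pow_atTop two_ne_zero).eventually_ge_atTop (8000 * K)).and
      (eventually_ge_atTop (1 / (400 * τ))))).exists
  have hM0 : 0 < M := by linarith
  refine ⟨M, hM, ?_, ?_⟩
  · rw [le_div_iff₀ (by positivity)]
    calc 20 * (K / M ^ 3) * (400 * M) = 8000 * K / M ^ 2 := by field_simp; ring
      _ ≤ 1 := div_le_one_of_le₀ hMK (by positivity)
  · rw [div_le_iff₀ (by positivity)] at hMτ ⊢
    linarith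

theorem exists_isNondegenerateBrodyCurve (hN : 1 ≤ N) (hf : IsHolomorphic f) {s ε : ℝ}
    (hs : s < 1) (hfs : ∀ z, sphericalDeriv f z ≤ s) (hε : 0 < ε) :
    ∃ g : ℂ → CP N, IsNondegenerateBrodyCurve g ∧ (∃ s' < 1, ∀ z, sphericalDeriv g z ≤ s') ∧
      ∀ z, sphericalDeriv f z ^ 2 ≤ sphericalDeriv g z ^ 2 + ε := by
  obtain ⟨M, hM, hη, hδ⟩ := exists_spacing (6 ^ 3 * poleSumConst) (lt_min (sub_pos.2 hs) hε)
  obtain ⟨hδs, hδε⟩ := le_min_iff.1 hδ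
  have hδ0 : 0 < 1 / (400 * M) := by positivity
  have hδ' : 1 / (400 * M) ≤ 1 / 400 := by gcongr; linarith
  have hf1 (z : ℂ) : sphericalDeriv f z ≤ 1 := (hfs z).trans hs.le
  obtain ⟨g, hfg⟩ := exists_isBubbling hN ⟨hf, hf1⟩ hM le_rfl (by linarith) subset_rfl
  have hg := hfg.sphericalDeriv_le hfs
  have hs' : max (s + 10 * (6 ^ 3 * poleSumConst / M ^ 3)) (4 / 5) < 1 :=
    max_lt (by linarith) (by norm_num)
  have hg1 (z : ℂ) : sphericalDeriv g z ≤ 1 := (hg z).trans hs'.le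
  exact ⟨g, hfg.isNondegenerateBrodyCurve hM hδ0 hη hg1, ⟨_, hs', hg⟩,
    hfg.sphericalDeriv_sq_le subset_rfl hf1 hg1 hδε (hη.trans hδε)⟩

end Conclusion

end BrodyCurves

theorem mainTheorem4 (N : ℕ) (hN : 1 ≤ N) (f : ℂ → BrodyCurves.CP N)
    (hf : BrodyCurves.IsHolomorphic f) (hf1 : BrodyCurves.derivSupNorm f Set.univ < 1)
    (ε : ℝ) (hε : 0 < ε) :
    Tendsto (BrodyCurves.meanEnergy f) atTop (𝓝 (BrodyCurves.energyDensity f)) ∧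
    ∃ g : ℂ → BrodyCurves.CP N,
      BrodyCurves.IsNondegenerateBrodyCurve g ∧
      BrodyCurves.derivSupNorm g Set.univ < 1 ∧
      Tendsto (BrodyCurves.meanEnergy g) atTop (𝓝 (BrodyCurves.energyDensity g)) ∧
      BrodyCurves.energyDensity g ≥ BrodyCurves.energyDensity f - ε := by
  have hs : (BrodyCurves.derivSupNorm f Set.univ).toReal < 1 :=
    (ENNReal.toReal_lt_toReal hf1.ne_top ENNReal.one_ne_top).2 hf1
  have hfs (z : ℂ) := BrodyCurves.sphericalDeriv_le_toReal_derivSupNorm hf1.ne_top (Set.mem_univ z)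
  have hfB : BrodyCurves.IsBrodyCurve f := ⟨hf, fun z => (hfs z).trans hs.le⟩
  obtain ⟨g, hg, ⟨s', hs', hgs⟩, hsq⟩ :=
    BrodyCurves.exists_isNondegenerateBrodyCurve hN hf hs hfs hε
  refine ⟨hfB.tendsto_meanEnergy, g, hg, ?_, hg.1.tendsto_meanEnergy, ?_⟩
  · exact (BrodyCurves.derivSupNorm_le fun z _ => hgs z).trans_lt (ENNReal.ofReal_lt_one.2 hs')
  · exact sub_le_iff_le_add.2 (BrodyCurves.energyDensity_le_add hfB hg.1 hε.le hsq)
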